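/- Let $0<a<1$. Call a closed filled rhombus with horizontal and vertical diagonals \emph{horizontal} if its height is $a$ times its width, and \emph{vertical} if its width is $a$ times its height. Start with the horizontal rhombus of height $2$ and width $2/a$ centered at the origin, regarded as the only polygon at stage $0$. At iteration $k\ge 1$, place into each polygon of stage $k-1$ the largest vertical rhombus it contains if $k$ is odd, respectively the largest horizontal rhombus it contains if $k$ is even; the closures of the connected components of what is left of these polygons are the (closed, filled) \emph{empty polygons} at iteration $k$. Let $F^a_k$ be the union of the empty polygons at iteration $k$, let $F^a=\bigcap_{k\ge1}F^a_k$, and let $E^a=\{(x,y)\in F^a : x\ge 0,\ y\ge 0\}$ be its upper-right quarter. Put $$A=(a,0),\quad B=\Bigl(\tfrac{1+a^2}{2a},\tfrac{1-a^2}{2}\Bigr),\quad C=(0,1),\quad D=\Bigl(\tfrac{a(1+a^2)}{2},\tfrac{1-a^2}{2}\Bigr),\quad G=(a,1-a^2),$$ $$H=\Bigl(\tfrac{a(3-a^2)}{2},\tfrac{1-a^2}{2}\Bigr),\quad E=\Bigl(\tfrac{1+4a^2-a^4}{4a},\tfrac{1-a^4}{4}\Bigr),\quad F=\Bigl(\tfrac{1+4a^2-a^4}{4a},\tfrac{(1-a^2)(3-a^2)}{4}\Bigr).$$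 Then there are contracting similarities $S_1,S_2,S_3$ of $\mathbb{R}^2$ with ratios $a$, $\frac{1-a^2}{2}$, $\frac{1-a^2}{2}$, taking $(A,B,C)$ to $(G,D,C)$, $(H,F,G)$, $(H,E,A)$ respectively, such that $E^a$ is their attractor, i.e. the unique nonempty compact set $K$ with $K=S_1(K)\cup S_2(K)\cup S_3(K)$. These similarities satisfy the open set condition with $V$ the open triangle $ABC$: the set $V$ is nonempty, bounded and open, and $S_1(V),S_2(V),S_3(V)$ are pairwise disjoint subsets of $V$. Moreover there is a unique real $s$ with $$a^s+2\Bigl(\frac{1-a^2}{2}\Bigr)^s=1,$$ and this $s$ satisfies $s\ge0$ and $\dim_{\mathrm H}E^a=\dim_{\mathrm H}F^a=s$. -/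

import Mathlib

namespace Gasket

/-- The Euclidean plane. -/
abbrev Plane : Type := EuclideanSpace ℝ (Fin 2)

/-! ### The gasket construction -/

/-- The two orientations of the rhombi in the construction. -/
inductive RhombusType
  | horizontal
  | vertical

/-- The closed filled rhombus with centre `c`. The horizontal one has height `2 * h` and width
`2 * h / a` (aspect ratio `1 : a`); the vertical one has width `2 * h` and height `2 * h / a`
(aspect ratio `a : 1`). -/
def rhombus (a : ℝ) : RhombusType → Plane → ℝ → Set Plane
  | .horizontal, c, h => {p | a * |p 0 - c 0| + |p 1 - c 1| ≤ h}
  | .vertical, c, h => {p | |p 0 - c 0| + a * |p 1 - c 1| ≤ h}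

/-- The rhombus of type `o` with centre `c` and size `h` is nondegenerate, lies in `P`, and no
rhombus of the same type lying in `P` is larger. -/
def IsLargestRhombus (a : ℝ) (o : RhombusType) (P : Set Plane) (c : Plane) (h : ℝ) : Prop :=
  0 < h ∧ rhombus a o c h ⊆ P ∧
    ∀ (c' : Plane) (h' : ℝ), rhombus a o c' h' ⊆ P → h' ≤ h

/-- The orientation of the rhombi placed at iteration `k`: vertical for odd `k`, horizontal for
even `k` (the initial rhombus, `k = 0`, is horizontal). -/
def rhombusTypeAt (k : ℕ) : RhombusType :=
  if Even k then .horizontal else .vertical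

/-- The (closed, filled) empty polygons at iteration `k`. The construction starts (`k = 0`) with
the horizontal rhombus of height `2` and width `2 / a` centred at the origin. At iteration `k + 1`
the largest possible rhombus of the current orientation is placed into each polygon `P` of
iteration `k`; the new empty polygons are the closures of the connected components of what is left
of `P`. -/
def emptyPolygons (a : ℝ) : ℕ → Set (Set Plane)
  | 0 => {rhombus a .horizontal 0 1}
  | k + 1 => {Q | ∃ P ∈ emptyPolygons a k, ∃ (c : Plane) (h : ℝ),
      IsLargestRhombus a (rhombusTypeAt (k + 1)) P c h ∧
      ∃ x ∈ P \ rhombus a (rhombusTypeAt (k + 1)) c h,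
        Q = closure (connectedComponentIn (P \ rhombus a (rhombusTypeAt (k + 1)) c h) x)}

/-- The union of the empty polygons at iteration `k`. -/
def iterate (a : ℝ) (k : ℕ) : Set Plane := ⋃₀ emptyPolygons a k

/-- The fractal `F^a`: the intersection over `k ≥ 1` of the unions of empty polygons. -/
def fractal (a : ℝ) : Set Plane := ⋂ (k : ℕ) (_ : 1 ≤ k), iterate a k

/-- The upper-right quarter `E^a` of `F^a`, endpoints included. -/
def quarter (a : ℝ) : Set Plane := fractal a ∩ {p | 0 ≤ p 0 ∧ 0 ≤ p 1}

/-! ### Self-similar sets -/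

/-- `S` is a contracting similarity of ratio `c`. -/
def IsContractingSimilarity (S : Plane → Plane) (c : ℝ) : Prop :=
  0 < c ∧ c < 1 ∧ ∀ x y, dist (S x) (S y) = c * dist x y

/-- The family `S` satisfies the open set condition, with open set `V`. -/
def OpenSetConditionFor {m : ℕ} (S : Fin m → Plane → Plane) (V : Set Plane) : Prop :=
  V.Nonempty ∧ Bornology.IsBounded V ∧ IsOpen V ∧
    (⋃ i, S i '' V) ⊆ V ∧ Pairwise fun i j => Disjoint (S i '' V) (S j '' V)

/-- `K` is the attractor of the family `S`: the unique nonempty compact set that is the union of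
its images under the maps of the family. -/
def IsAttractor {m : ℕ} (S : Fin m → Plane → Plane) (K : Set Plane) : Prop :=
  (K.Nonempty ∧ IsCompact K ∧ K = ⋃ i, S i '' K) ∧
    ∀ L : Set Plane, L.Nonempty → IsCompact L → L = ⋃ i, S i '' L → L = K

/-! ### The labelled points of the upper-right wedge

`A B C` is the upper-right empty triangle at iteration 2, with right angle at `A`; `A H G D` is the
vertical rhombus placed in it at iteration 3; `H F B E` is the horizontal rhombus placed at
iteration 4 in the remaining dart `A H G B`. -/

noncomputable def ptA (a : ℝ) : Plane := !₂[a, 0]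
noncomputable def ptB (a : ℝ) : Plane := !₂[(1 + a ^ 2) / (2 * a), (1 - a ^ 2) / 2]
noncomputable def ptC : Plane := !₂[0, 1]
noncomputable def ptD (a : ℝ) : Plane := !₂[a * (1 + a ^ 2) / 2, (1 - a ^ 2) / 2]
noncomputable def ptE (a : ℝ) : Plane := !₂[(1 + 4 * a ^ 2 - a ^ 4) / (4 * a), (1 - a ^ 4) / 4]
noncomputable def ptF (a : ℝ) : Plane :=
  !₂[(1 + 4 * a ^ 2 - a ^ 4) / (4 * a), (1 - a ^ 2) * (3 - a ^ 2) / 4]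
noncomputable def ptG (a : ℝ) : Plane := !₂[a, 1 - a ^ 2]
noncomputable def ptH (a : ℝ) : Plane := !₂[a * (3 - a ^ 2) / 2, (1 - a ^ 2) / 2]

end Gasket

/-! Only three shapes occur up to similarity. The first cut leaves two mirror-image darts, a
horizontal cut of a dart leaves two mirror-image triangles, and a vertical cut of the triangle `A B
C` leaves a copy of the triangle shrunk by `a` and a copy of the dart shrunk by `(1 - a ^ 2) / 2`.
The first copy exchanges the axes, as the alternation of orientations demands. Splitting the small
dart at the next stage gives `triangleIterate_add_two`: piece 0 appears one stage later, pieces 1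
and 2 two stages later. Since the iterates decrease, their intersection is invariant under the three
maps (`limitSet_eq_iUnion`), and it is the quarter `E^a` because the whole picture is symmetric in
both axes.

The dimension does not go through the open set condition or Hausdorff measure. The three pieces form
a chain from `C` to `A`: consecutive pieces meet in exactly one point (`G`, then `H`), the outer two
are disjoint, and all of this holds with linear bounds on distances. With `p i = c i ^ s`, Moran's
equation says that intervals of lengths `p i` tile `[0, 1]`, and the attractor is coded by a map `g`
onto `[0, 1]` that conjugates the two chains (`IsChain.exists_address`). Both the distance and `|g x
- g y| ^ (1 / s)` are multiplied by `c i` under the `i`-th map and spread linearly away from the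
joints; any two such gauges are comparable (`IsChainGauge.exists_le`). Hence `g` is `s`-Hölder, its
inverse is `1 / s`-Hölder, and the dimension is `s` times that of `[0, 1]`. -/

open Set Filter Topology

namespace Gasket

/-! ### Chains of three pieces and the comparison of gauges on them -/

section Chain

variable {α : Type*}

/-- A three-map system whose pieces form a chain `C -- S 0 A = S 1 C -- S 1 A = S 2 A -- A`. -/
structure IsChain (S : Fin 3 → α → α) (c : Fin 3 → ℝ) (K : Set α) (A C : α) : Prop where
  pos : ∀ i, 0 < c i
  lt_one : ∀ i, c i < 1
  eq_iUnion : K = ⋃ i, S i '' K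
  memA : A ∈ K
  memC : C ∈ K
  map_zero_C : S 0 C = C
  map_one_C : S 1 C = S 0 A
  map_two_A : S 2 A = S 1 A
  map_two_C : S 2 C = A

/-- A quasi-metric adapted to a chain: it is scaled by the maps, and distinct pieces of the chain
spread linearly away from their common point. -/
structure IsChainGauge (S : Fin 3 → α → α) (c : Fin 3 → ℝ) (K : Set α) (A C : α)
    (ρ : α → α → ℝ) : Prop where
  symm : ∀ x y, ρ x y = ρ y x
  nonneg : ∀ x y, 0 ≤ ρ x y
  bounded : ∃ D, ∀ x ∈ K, ∀ y ∈ K, ρ x y ≤ D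
  map : ∀ i, ∀ x ∈ K, ∀ y ∈ K, ρ (S i x) (S i y) = c i * ρ x y
  quasi : ∃ M, 0 ≤ M ∧ ∀ x ∈ K, ∀ y ∈ K, ∀ z ∈ K, ρ x z ≤ M * (ρ x y + ρ y z)
  zero_one : ∃ L, 0 < L ∧ ∀ x ∈ K, ∀ y ∈ K, ρ (S 0 x) (S 0 A) ≤ L * ρ (S 0 x) (S 1 y) ∧
    ρ (S 1 y) (S 0 A) ≤ L * ρ (S 0 x) (S 1 y)
  one_two : ∃ L, 0 < L ∧ ∀ x ∈ K, ∀ y ∈ K, ρ (S 1 x) (S 1 A) ≤ L * ρ (S 1 x) (S 2 y) ∧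
    ρ (S 2 y) (S 1 A) ≤ L * ρ (S 1 x) (S 2 y)
  zero_two : ∃ δ, 0 < δ ∧ ∀ x ∈ K, ∀ y ∈ K, δ ≤ ρ (S 0 x) (S 2 y)
  pos : 0 < ρ A C

/-- Lets the comparisons below be proved by induction on `n`: each descent into a piece shrinks the
error term `q ^ n * D`, so no infinite addresses are needed. -/
lemma le_of_forall_le_add_geometric {u v q D : ℝ} (h0 : 0 ≤ q) (h1 : q < 1)
    (h : ∀ n : ℕ, u ≤ v + q ^ n * D) : u ≤ v := by
  have : Tendsto (fun n : ℕ => v + q ^ n * D) atTop (𝓝 (v + 0 * D)) :=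
    ((tendsto_pow_atTop_nhds_zero_of_lt_one h0 h1).mul_const D).const_add v
  have := ge_of_tendsto' this h
  simpa using this

variable {S : Fin 3 → α → α} {c : Fin 3 → ℝ} {K : Set α} {A C : α} {ρ₁ ρ₂ : α → α → ℝ}

lemma IsChain.exists_preimage (hS : IsChain S c K A C) {x : α} (hx : x ∈ K) :
    ∃ i, ∃ y ∈ K, S i y = x := by
  rw [hS.eq_iUnion] at hx
  simpa using hx

lemma IsChain.map_mem (hS : IsChain S c K A C) (i : Fin 3) {x : α} (hx : x ∈ K) : S i x ∈ K := by
  rw [hS.eq_iUnion]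
  exact mem_iUnion.2 ⟨i, x, hx, rfl⟩

/-- `C = S 0 C` lies in piece 0. Piece 2 is far from piece 0, and the spreading bound at the joint
`S 0 A`, applied to `C` itself, keeps piece 1 away, since `C` is at gauge distance `c 0 * ρ₂ A C`
from that joint. -/
lemma IsChainGauge.exists_lower_C (hS : IsChain S c K A C) (h : IsChainGauge S c K A C ρ₂) :
    ∃ δ, 0 < δ ∧ ∀ i, i ≠ 0 → ∀ x ∈ K, δ ≤ ρ₂ (S i x) C := by
  obtain ⟨L, hL, h01⟩ := h.zero_one
  obtain ⟨δ, hδ, h02⟩ := h.zero_two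
  have hp : 0 < c 0 * ρ₂ A C / L := div_pos (mul_pos (hS.pos 0) h.pos) hL
  refine ⟨min δ (c 0 * ρ₂ A C / L), lt_min hδ hp, fun i hi x hx => ?_⟩
  fin_cases i
  · exact absurd rfl hi
  · refine (min_le_right _ _).trans ?_
    have := (h01 C hS.memC x hx).1
    rw [h.map 0 C hS.memC A hS.memA, h.symm C A, hS.map_zero_C, h.symm C] at this
    rw [div_le_iff₀ hL]
    change c 0 * ρ₂ A C ≤ ρ₂ (S 1 x) C * L
    linarith
  · refine (min_le_left _ _).trans ?_
    have := h02 C hS.memC x hx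
    rwa [hS.map_zero_C, h.symm C] at this

lemma IsChainGauge.exists_lower_A (hS : IsChain S c K A C) (h : IsChainGauge S c K A C ρ₂) :
    ∃ δ, 0 < δ ∧ ∀ i, i ≠ 2 → ∀ x ∈ K, δ ≤ ρ₂ (S i x) A := by
  obtain ⟨L, hL, h12⟩ := h.one_two
  obtain ⟨δ, hδ, h02⟩ := h.zero_two
  have hp : 0 < c 2 * ρ₂ A C / L := div_pos (mul_pos (hS.pos 2) h.pos) hL
  refine ⟨min δ (c 2 * ρ₂ A C / L), lt_min hδ hp, fun i hi x hx => ?_⟩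
  fin_cases i
  · refine (min_le_left _ _).trans ?_
    have := h02 x hx C hS.memC
    rwa [hS.map_two_C] at this
  · refine (min_le_right _ _).trans ?_
    have := (h12 x hx C hS.memC).2
    rw [← hS.map_two_A, h.map 2 C hS.memC A hS.memA, h.symm C A, hS.map_two_C] at this
    rw [div_le_iff₀ hL]
    change c 2 * ρ₂ A C ≤ ρ₂ (S 1 x) A * L
    linarith
  · exact absurd rfl hi

/-- Zooming in at the fixed point `C` of `S 0` scales both gauges by `c 0`; once a point leaves
piece 0, `ρ₂` is bounded below and `ρ₁` above. -/
lemma IsChainGauge.exists_le_C (hS : IsChain S c K A C) (h₁ : IsChainGauge S c K A C ρ₁)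
    (h₂ : IsChainGauge S c K A C ρ₂) :
    ∃ B, 0 ≤ B ∧ ∀ x ∈ K, ρ₁ x C ≤ B * ρ₂ x C := by
  obtain ⟨D, hD⟩ := h₁.bounded
  have hD0 : 0 ≤ D := (h₁.nonneg A C).trans (hD A hS.memA C hS.memC)
  obtain ⟨δ, hδ, hlow⟩ := h₂.exists_lower_C hS
  have hB : 0 ≤ D / δ := by positivity
  refine ⟨D / δ, hB, fun x hx => le_of_forall_le_add_geometric (hS.pos 0).le (hS.lt_one 0)
    (D := D) fun n => ?_⟩
  induction n generalizing x with
  | zero =>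
    have := mul_nonneg hB (h₂.nonneg x C)
    have := hD x hx C hS.memC
    simp only [pow_zero, one_mul]; linarith
  | succ n ih =>
    obtain ⟨i, y, hy, rfl⟩ := hS.exists_preimage hx
    by_cases hi : i = 0
    · subst hi
      have e₁ := h₁.map 0 y hy C hS.memC
      have e₂ := h₂.map 0 y hy C hS.memC
      rw [hS.map_zero_C] at e₁ e₂
      rw [e₁, e₂, pow_succ]
      have := mul_le_mul_of_nonneg_left (ih y hy) (hS.pos 0).le
      linarith
    · have h1 := hlow i hi y hy
      have h2 : D ≤ D / δ * ρ₂ (S i y) C := by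
        rw [div_mul_eq_mul_div, le_div_iff₀ hδ]
        exact mul_le_mul_of_nonneg_left h1 hD0
      have h3 := hD (S i y) hx C hS.memC
      have h4 : 0 ≤ c 0 ^ (n + 1) * D := mul_nonneg (pow_nonneg (hS.pos 0).le _) hD0
      linarith

/-- Since `A = S 2 C`, near `A` this is the comparison at `C` seen through `S 2`. -/
lemma IsChainGauge.exists_le_A (hS : IsChain S c K A C) (h₁ : IsChainGauge S c K A C ρ₁)
    (h₂ : IsChainGauge S c K A C ρ₂) :
    ∃ B, 0 ≤ B ∧ ∀ x ∈ K, ρ₁ x A ≤ B * ρ₂ x A := by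
  obtain ⟨D, hD⟩ := h₁.bounded
  have hD0 : 0 ≤ D := (h₁.nonneg A C).trans (hD A hS.memA C hS.memC)
  obtain ⟨δ, hδ, hlow⟩ := h₂.exists_lower_A hS
  obtain ⟨B, hB, hC⟩ := h₁.exists_le_C hS h₂
  refine ⟨max B (D / δ), le_max_of_le_left hB, fun x hx => ?_⟩
  obtain ⟨i, y, hy, rfl⟩ := hS.exists_preimage hx
  by_cases hi : i = 2
  · subst hi
    have e₁ := h₁.map 2 y hy C hS.memC
    have e₂ := h₂.map 2 y hy C hS.memC
    rw [hS.map_two_C] at e₁ e₂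
    rw [e₁, e₂]
    have h1 := mul_le_mul_of_nonneg_left (hC y hy) (hS.pos 2).le
    have h2 := mul_le_mul_of_nonneg_right (le_max_left B (D / δ))
      (mul_nonneg (hS.pos 2).le (h₂.nonneg y C))
    linarith
  · calc ρ₁ (S i y) A ≤ D := hD _ hx _ hS.memA
      _ = D / δ * δ := by field_simp
      _ ≤ D / δ * ρ₂ (S i y) A := mul_le_mul_of_nonneg_left (hlow i hi y hy) (by positivity)
      _ ≤ _ := mul_le_mul_of_nonneg_right (le_max_right _ _) (h₂.nonneg _ _)

/-- Comparison across two pieces of the chain meeting at `S i P = S j Q`. -/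
lemma IsChainGauge.exists_le_adjacent (hS : IsChain S c K A C) (h₁ : IsChainGauge S c K A C ρ₁)
    (h₂ : IsChainGauge S c K A C ρ₂) {i j : Fin 3} {P Q : α} (hP : P ∈ K) (hQ : Q ∈ K)
    (hPQ : S j Q = S i P)
    (hBP : ∃ B, 0 ≤ B ∧ ∀ x ∈ K, ρ₁ x P ≤ B * ρ₂ x P)
    (hBQ : ∃ B, 0 ≤ B ∧ ∀ x ∈ K, ρ₁ x Q ≤ B * ρ₂ x Q)
    (hL : ∃ L, 0 < L ∧ ∀ x ∈ K, ∀ y ∈ K, ρ₂ (S i x) (S i P) ≤ L * ρ₂ (S i x) (S j y) ∧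
      ρ₂ (S j y) (S i P) ≤ L * ρ₂ (S i x) (S j y)) :
    ∃ B, 0 ≤ B ∧ ∀ x ∈ K, ∀ y ∈ K, ρ₁ (S i x) (S j y) ≤ B * ρ₂ (S i x) (S j y) := by
  obtain ⟨M, hM, hq⟩ := h₁.quasi
  obtain ⟨B, hB, hBP⟩ := hBP
  obtain ⟨B', hB', hBQ⟩ := hBQ
  obtain ⟨L, hL, hl⟩ := hL
  -- The path goes through the joint `S i P`: `M` is the quasi-triangle constant of `ρ₁`, `B` and
  -- `B'` compare the gauges towards the joint, and `L` bounds both legs by the `ρ₂`-distance of the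
  -- endpoints.
  refine ⟨M * (B * L + B' * L), by positivity, fun x hx y hy => ?_⟩
  have e1 : ρ₁ (S i x) (S i P) ≤ B * (L * ρ₂ (S i x) (S j y)) := by
    refine le_trans ?_ (mul_le_mul_of_nonneg_left (hl x hx y hy).1 hB)
    rw [h₁.map i x hx P hP, h₂.map i x hx P hP]
    linarith [mul_le_mul_of_nonneg_left (hBP x hx) (hS.pos i).le]
  have e2 : ρ₁ (S i P) (S j y) ≤ B' * (L * ρ₂ (S i x) (S j y)) := by
    refine le_trans ?_ (mul_le_mul_of_nonneg_left (hl x hx y hy).2 hB')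
    rw [h₁.symm, ← hPQ, h₁.map j y hy Q hQ, h₂.map j y hy Q hQ]
    linarith [mul_le_mul_of_nonneg_left (hBQ y hy) (hS.pos j).le]
  have e3 := hq (S i x) (hS.map_mem i hx) (S i P) (hS.map_mem i hP) (S j y) (hS.map_mem j hy)
  have e4 := mul_le_mul_of_nonneg_left (add_le_add e1 e2) hM
  linarith

/-- Any two gauges on a chain are comparable. -/
theorem IsChainGauge.exists_le (hS : IsChain S c K A C) (h₁ : IsChainGauge S c K A C ρ₁)
    (h₂ : IsChainGauge S c K A C ρ₂) :
    ∃ B, 0 ≤ B ∧ ∀ x ∈ K, ∀ y ∈ K, ρ₁ x y ≤ B * ρ₂ x y := by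
  obtain ⟨D, hD⟩ := h₁.bounded
  have hD0 : 0 ≤ D := (h₁.nonneg A C).trans (hD A hS.memA C hS.memC)
  have hA := h₁.exists_le_A hS h₂
  have hC := h₁.exists_le_C hS h₂
  obtain ⟨B1, hB1, h01⟩ := h₁.exists_le_adjacent hS h₂ hS.memA hS.memC hS.map_one_C hA hC h₂.zero_one
  obtain ⟨B2, hB2, h12⟩ := h₁.exists_le_adjacent hS h₂ hS.memA hS.memA hS.map_two_A hA hA h₂.one_two
  obtain ⟨δ, hδ, h02⟩ := h₂.zero_two
  have hB3 : 0 ≤ D / δ := by positivity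
  obtain ⟨B, hB1', hB2', hB3'⟩ : ∃ B, B1 ≤ B ∧ B2 ≤ B ∧ D / δ ≤ B :=
    ⟨max B1 (max B2 (D / δ)), by simp, by simp, by simp⟩
  have hB : 0 ≤ B := hB1.trans hB1'
  have k01 : ∀ x ∈ K, ∀ y ∈ K, ρ₁ (S 0 x) (S 1 y) ≤ B * ρ₂ (S 0 x) (S 1 y) := fun x hx y hy =>
    (h01 x hx y hy).trans (mul_le_mul_of_nonneg_right hB1' (h₂.nonneg _ _))
  have k12 : ∀ x ∈ K, ∀ y ∈ K, ρ₁ (S 1 x) (S 2 y) ≤ B * ρ₂ (S 1 x) (S 2 y) := fun x hx y hy =>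
    (h12 x hx y hy).trans (mul_le_mul_of_nonneg_right hB2' (h₂.nonneg _ _))
  have k02 : ∀ x ∈ K, ∀ y ∈ K, ρ₁ (S 0 x) (S 2 y) ≤ B * ρ₂ (S 0 x) (S 2 y) := fun x hx y hy =>
    calc ρ₁ (S 0 x) (S 2 y) ≤ D := hD _ (hS.map_mem 0 hx) _ (hS.map_mem 2 hy)
      _ = D / δ * δ := by field_simp
      _ ≤ D / δ * ρ₂ (S 0 x) (S 2 y) := mul_le_mul_of_nonneg_left (h02 x hx y hy) hB3
      _ ≤ _ := mul_le_mul_of_nonneg_right hB3' (h₂.nonneg _ _)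
  obtain ⟨q, hq0, hq1, hq⟩ : ∃ q, 0 ≤ q ∧ q < 1 ∧ ∀ i, c i ≤ q := by
    refine ⟨max (c 0) (max (c 1) (c 2)), le_max_of_le_left (hS.pos 0).le,
      max_lt (hS.lt_one 0) (max_lt (hS.lt_one 1) (hS.lt_one 2)), fun i => ?_⟩
    fin_cases i <;> simp
  refine ⟨B, hB, fun x hx y hy => le_of_forall_le_add_geometric hq0 hq1 (D := D) fun n => ?_⟩
  induction n generalizing x y with
  | zero =>
    have := mul_nonneg hB (h₂.nonneg x y)
    have := hD x hx y hy
    simp only [pow_zero, one_mul]; linarith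
  | succ n ih =>
    have hnn : 0 ≤ q ^ (n + 1) * D := by positivity
    obtain ⟨i, u, hu, rfl⟩ := hS.exists_preimage hx
    obtain ⟨j, v, hv, rfl⟩ := hS.exists_preimage hy
    -- In a common piece both gauges scale by `c i`, so the induction continues; in different pieces
    -- the bound holds with no error term.
    by_cases hij : i = j
    · subst hij
      rw [h₁.map i u hu v hv, h₂.map i u hu v hv, pow_succ]
      have e1 := mul_le_mul_of_nonneg_left (ih u hu v hv) (hS.pos i).le
      have e2 := mul_le_mul_of_nonneg_right (hq i) (show 0 ≤ q ^ n * D by positivity)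
      linarith
    · suffices h : ρ₁ (S i u) (S j v) ≤ B * ρ₂ (S i u) (S j v) by linarith
      have flip : ρ₁ (S j v) (S i u) ≤ B * ρ₂ (S j v) (S i u) →
          ρ₁ (S i u) (S j v) ≤ B * ρ₂ (S i u) (S j v) := fun h => by
        rwa [h₁.symm, h₂.symm]
      fin_cases i <;> fin_cases j
      · exact absurd rfl hij
      · exact k01 u hu v hv
      · exact k02 u hu v hv
      · exact flip (k01 v hv u hu)
      · exact absurd rfl hij
      · exact k12 u hu v hv
      · exact flip (k02 v hv u hu)
      · exact flip (k12 v hv u hu)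
      · exact absurd rfl hij

end Chain

/-! ### Coding a chain by the unit interval, and its dimension -/

section Dimension

/-- The affine maps of a chain of three consecutive intervals of lengths `p 0, p 1, p 2`, the last
one traversed backwards. -/
def chainLine (p : Fin 3 → ℝ) : Fin 3 → ℝ → ℝ :=
  ![fun t => p 0 * t, fun t => p 0 + p 1 * t, fun t => 1 - p 2 * t]

variable {p : Fin 3 → ℝ}

@[simp] lemma chainLine_zero (t : ℝ) : chainLine p 0 t = p 0 * t := rfl
@[simp] lemma chainLine_one (t : ℝ) : chainLine p 1 t = p 0 + p 1 * t := rfl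
@[simp] lemma chainLine_two (t : ℝ) : chainLine p 2 t = 1 - p 2 * t := rfl

lemma abs_chainLine_sub (hp : ∀ i, 0 < p i) (i : Fin 3) (t u : ℝ) :
    |chainLine p i t - chainLine p i u| = p i * |t - u| := by
  have h : p i * |t - u| = |p i * (t - u)| := by rw [abs_mul, abs_of_pos (hp i)]
  rw [h]
  fin_cases i
  · simp [mul_sub]
  · simp [mul_sub]
  · rw [← abs_neg]; simp [mul_sub]

lemma chainLine_mem_Icc (hp : ∀ i, 0 < p i) (hsum : p 0 + p 1 + p 2 = 1) (i : Fin 3) {t : ℝ}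
    (ht : t ∈ Icc (0 : ℝ) 1) : chainLine p i t ∈ Icc (0 : ℝ) 1 := by
  have h0 := hp 0
  have h1 := hp 1
  have h2 := hp 2
  obtain ⟨ht0, ht1⟩ := ht
  fin_cases i
  · exact ⟨by simp; positivity, by simp; nlinarith⟩
  · exact ⟨by simp; positivity, by simp; nlinarith⟩
  · exact ⟨by simp; nlinarith, by simp; positivity⟩

lemma lt_one_of_sum_eq_one (hp : ∀ i, 0 < p i) (hsum : p 0 + p 1 + p 2 = 1) (i : Fin 3) :
    p i < 1 := by
  have h0 := hp 0
  have h1 := hp 1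
  have h2 := hp 2
  fin_cases i <;> simp <;> linarith

/-- A nonempty compact invariant set of contractions is unique. -/
lemma subset_of_invariant {α ι : Type*} [MetricSpace α] {S : ι → α → α} {q : ℝ} (hq1 : q < 1)
    (hS : ∀ i x y, dist (S i x) (S i y) ≤ q * dist x y) {K L : Set α}
    (hK : IsCompact K) (hKn : K.Nonempty) (hKS : ∀ i, S i '' K ⊆ K)
    (hL : IsCompact L) (hLS : L ⊆ ⋃ i, S i '' L) : L ⊆ K := by
  rcases L.eq_empty_or_nonempty with rfl | hLn
  · exact empty_subset _
  -- A point `z` of `L` farthest from `K` is an image `S i w` with `w ∈ L`, so its distance to `K`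
  -- is at most `q` times the largest distance, which is therefore zero.
  obtain ⟨z, hz, hmax⟩ := hL.exists_isMaxOn hLn
    (Metric.continuous_infDist_pt K).continuousOn
  have hmax' : ∀ w ∈ L, Metric.infDist w K ≤ Metric.infDist z K := hmax
  have hz0 : Metric.infDist z K ≤ q * Metric.infDist z K ∨ Metric.infDist z K ≤ 0 := by
    obtain ⟨i, w, hw, rfl⟩ := mem_iUnion.1 (hLS hz)
    obtain ⟨k, hk, hkw⟩ := hK.exists_infDist_eq_dist hKn w
    have h1 : Metric.infDist (S i w) K ≤ q * dist w k :=
      (Metric.infDist_le_dist_of_mem (hKS i ⟨k, hk, rfl⟩)).trans (hS i w k)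
    rw [← hkw] at h1
    by_cases hq : 0 ≤ q
    · exact Or.inl (h1.trans (mul_le_mul_of_nonneg_left (hmax' w hw) hq))
    · right
      exact h1.trans (mul_nonpos_of_nonpos_of_nonneg (not_le.1 hq).le Metric.infDist_nonneg)
  have hz1 : Metric.infDist z K ≤ 0 := by
    rcases hz0 with h | h
    · nlinarith [@Metric.infDist_nonneg α _ K z]
    · exact h
  intro x hx
  exact (hK.isClosed.mem_iff_infDist_zero hKn).2
    (le_antisymm ((hmax' x hx).trans hz1) Metric.infDist_nonneg)

variable {α : Type*} {S : Fin 3 → α → α} {c : Fin 3 → ℝ} {K : Set α} {A C : α}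

/-- For an exponent `e` not known to be at most `1`, the power `|t| ^ e` need not satisfy the
triangle inequality; this weaker form is all that `quasi` asks for. -/
lemma add_rpow_le_two_rpow_mul {u v e : ℝ} (hu : 0 ≤ u) (hv : 0 ≤ v) (he : 0 ≤ e) :
    (u + v) ^ e ≤ 2 ^ e * (u ^ e + v ^ e) := by
  have hu' := Real.rpow_nonneg hu e
  have hv' := Real.rpow_nonneg hv e
  have h2 : (0 : ℝ) ≤ 2 ^ e := by positivity
  rcases le_total u v with h | h
  · calc (u + v) ^ e ≤ (2 * v) ^ e := Real.rpow_le_rpow (by positivity) (by linarith) he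
      _ = 2 ^ e * v ^ e := Real.mul_rpow (by norm_num) hv
      _ ≤ _ := mul_le_mul_of_nonneg_left (by linarith) h2
  · calc (u + v) ^ e ≤ (2 * u) ^ e := Real.rpow_le_rpow (by positivity) (by linarith) he
      _ = 2 ^ e * u ^ e := Real.mul_rpow (by norm_num) hu
      _ ≤ _ := mul_le_mul_of_nonneg_left (by linarith) h2

/-- In the coordinate `g` the pieces are adjacent intervals, so a joint lies between points on its
two sides and `L = 1` works; the outer pieces are separated by the middle interval, of length `p 1`.
The power `e` turns the scale `p i` into `c i`. -/
lemma isChainGauge_address (hS : IsChain S c K A C) (hp : ∀ i, 0 < p i)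
    (hsum : p 0 + p 1 + p 2 = 1) {e : ℝ} (he : 0 < e) (hpe : ∀ i, p i ^ e = c i) {g : α → ℝ}
    (hmem : ∀ x ∈ K, g x ∈ Icc (0 : ℝ) 1) (hgC : g C = 0) (hgA : g A = 1)
    (hgS : ∀ i, ∀ x ∈ K, g (S i x) = chainLine p i (g x)) :
    IsChainGauge S c K A C fun x y => |g x - g y| ^ e where
  symm x y := by rw [abs_sub_comm]
  nonneg x y := by positivity
  bounded := ⟨1, fun x hx y hy => by
    refine Real.rpow_le_one (abs_nonneg _) ?_ he.le
    obtain ⟨h1, h2⟩ := hmem x hx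
    obtain ⟨h3, h4⟩ := hmem y hy
    rw [abs_le]; constructor <;> linarith⟩
  map i x hx y hy := by
    rw [hgS i x hx, hgS i y hy, abs_chainLine_sub hp, Real.mul_rpow (hp i).le (abs_nonneg _), hpe]
  quasi := ⟨2 ^ e, by positivity, fun x _ y _ z _ =>
    (Real.rpow_le_rpow (abs_nonneg _) (abs_sub_le _ (g y) _) he.le).trans
      (add_rpow_le_two_rpow_mul (abs_nonneg _) (abs_nonneg _) he.le)⟩
  zero_one := ⟨1, one_pos, fun x hx y hy => by
    rw [one_mul]
    obtain ⟨h1, h2⟩ := hmem x hx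
    obtain ⟨h3, h4⟩ := hmem y hy
    rw [hgS 0 x hx, hgS 0 A hS.memA, hgS 1 y hy, hgA]
    simp only [chainLine_zero, chainLine_one, mul_one]
    have k1 : p 0 * g x ≤ p 0 := by nlinarith [hp 0]
    have k2 : 0 ≤ p 1 * g y := mul_nonneg (hp 1).le h3
    constructor <;> refine Real.rpow_le_rpow (abs_nonneg _) ?_ he.le
    · rw [abs_sub_comm, abs_of_nonneg (by linarith), abs_sub_comm, abs_of_nonneg (by linarith)]
      linarith
    · rw [abs_of_nonneg (by linarith), abs_sub_comm, abs_of_nonneg (by linarith)]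
      linarith⟩
  one_two := ⟨1, one_pos, fun x hx y hy => by
    rw [one_mul]
    obtain ⟨h1, h2⟩ := hmem x hx
    obtain ⟨h3, h4⟩ := hmem y hy
    rw [hgS 1 x hx, hgS 1 A hS.memA, hgS 2 y hy, hgA]
    simp only [chainLine_two, chainLine_one, mul_one]
    have k1 : p 1 * g x ≤ p 1 := by nlinarith [hp 1]
    have k2 : p 2 * g y ≤ p 2 := by nlinarith [hp 2]
    constructor <;> refine Real.rpow_le_rpow (abs_nonneg _) ?_ he.le
    · rw [abs_sub_comm, abs_of_nonneg (by linarith), abs_sub_comm, abs_of_nonneg (by linarith)]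
      linarith
    · rw [abs_of_nonneg (by linarith), abs_sub_comm, abs_of_nonneg (by linarith)]
      linarith⟩
  zero_two := ⟨p 1 ^ e, Real.rpow_pos_of_pos (hp 1) e, fun x hx y hy => by
    obtain ⟨h1, h2⟩ := hmem x hx
    obtain ⟨h3, h4⟩ := hmem y hy
    rw [hgS 0 x hx, hgS 2 y hy]
    simp only [chainLine_zero, chainLine_two]
    have k1 : p 0 * g x ≤ p 0 := by nlinarith [hp 0]
    have k2 : p 2 * g y ≤ p 2 := by nlinarith [hp 2]
    have := hp 1
    refine Real.rpow_le_rpow this.le ?_ he.le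
    rw [abs_sub_comm, abs_of_nonneg (by linarith)]
    linarith⟩
  pos := by simp [hgA, hgC]

variable [MetricSpace α]

lemma IsChain.injective (hS : IsChain S c K A C)
    (hd : ∀ i x y, dist (S i x) (S i y) = c i * dist x y) (i : Fin 3) :
    Function.Injective (S i) := fun x y hxy => by
  have h := hd i x y
  rw [hxy, dist_self] at h
  have := (mul_eq_zero.1 h.symm).resolve_left (hS.pos i).ne'
  exact dist_eq_zero.1 this

/-- The map onto `[0, 1]` that conjugates the chain to a chain of intervals. -/
lemma IsChain.exists_address (hS : IsChain S c K A C)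
    (hd : ∀ i x y, dist (S i x) (S i y) = c i * dist x y)
    (hg : IsChainGauge S c K A C dist) (hp : ∀ i, 0 < p i) (hsum : p 0 + p 1 + p 2 = 1) :
    ∃ g : α → ℝ, (∀ x ∈ K, g x ∈ Icc (0 : ℝ) 1) ∧ g C = 0 ∧ g A = 1 ∧
      ∀ i, ∀ x ∈ K, g (S i x) = chainLine p i (g x) := by
  classical
  have hex : ∀ x, ∃ i y, x ∈ K → y ∈ K ∧ S i y = x := fun x => by
    by_cases hx : x ∈ K
    · obtain ⟨i, y, hy, h⟩ := hS.exists_preimage hx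
      exact ⟨i, y, fun _ => ⟨hy, h⟩⟩
    · exact ⟨0, x, fun h => absurd h hx⟩
  choose ι σ hισ using hex
  -- Iteration of the functional equation for a fixed choice `σ x` of preimage in piece `ι x`. The
  -- limit satisfies the equation for this choice only; independence of the choice is the remaining
  -- work.
  let G : ℕ → α → ℝ := fun n => Nat.rec (fun _ => 0) (fun _ g x => chainLine p (ι x) (g (σ x))) n
  have G0 : ∀ x, G 0 x = 0 := fun x => rfl
  have G1 : ∀ n x, G (n + 1) x = chainLine p (ι x) (G n (σ x)) := fun n x => rfl
  have hGmem : ∀ n x, G n x ∈ Icc (0 : ℝ) 1 := fun n => by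
    induction n with
    | zero => intro x; rw [G0]; simp
    | succ n ih => intro x; rw [G1]; exact chainLine_mem_Icc hp hsum _ (ih _)
  obtain ⟨q, hq0, hq1, hq⟩ : ∃ q, 0 ≤ q ∧ q < 1 ∧ ∀ i, p i ≤ q := by
    have := lt_one_of_sum_eq_one hp hsum
    refine ⟨max (p 0) (max (p 1) (p 2)), le_max_of_le_left (hp 0).le,
      max_lt (this 0) (max_lt (this 1) (this 2)), fun i => ?_⟩
    fin_cases i <;> simp
  have hGd : ∀ n x, dist (G n x) (G (n + 1) x) ≤ 1 * q ^ n := fun n => by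
    induction n with
    | zero =>
      intro x
      have := hGmem 1 x
      rw [G0, Real.dist_eq, zero_sub, abs_neg, zero_add, abs_of_nonneg this.1]
      simpa using this.2
    | succ n ih =>
      intro x
      rw [G1, G1 (n + 1), Real.dist_eq, abs_chainLine_sub hp, ← Real.dist_eq, pow_succ]
      have h1 := ih (σ x)
      have h2 := mul_le_mul (hq (ι x)) h1 dist_nonneg hq0
      linarith
  have hlim : ∀ x, ∃ t, Tendsto (fun n => G n x) atTop (𝓝 t) := fun x =>
    cauchySeq_tendsto_of_complete (cauchySeq_of_le_geometric q 1 hq1 fun n => hGd n x)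
  choose g hglim using hlim
  have hcont : ∀ i, Continuous (chainLine p i) := fun i => by
    fin_cases i
    · exact continuous_const.mul continuous_id
    · exact continuous_const.add (continuous_const.mul continuous_id)
    · exact continuous_const.sub (continuous_const.mul continuous_id)
  have hgeq : ∀ x, g x = chainLine p (ι x) (g (σ x)) := fun x =>
    tendsto_nhds_unique ((tendsto_add_atTop_iff_nat 1).2 (hglim x))
      (((hcont (ι x)).tendsto _).comp (hglim (σ x)))
  have hmem : ∀ x, g x ∈ Icc (0 : ℝ) 1 := fun x =>
    isClosed_Icc.mem_of_tendsto (hglim x) (Eventually.of_forall fun n => hGmem n x)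
  have hinj := hS.injective hd
  obtain ⟨δC, hδC, hlowC⟩ := hg.exists_lower_C hS
  obtain ⟨δA, hδA, hlowA⟩ := hg.exists_lower_A hS
  -- Only piece 0 contains `C`, so the chosen preimage is `C` itself and `g C` is the fixed point of
  -- `t ↦ p 0 * t`.
  have hgC : g C = 0 := by
    obtain ⟨h1, h2⟩ := hισ C hS.memC
    have hi : ι C = 0 := by
      by_contra hi
      have := hlowC _ hi _ h1
      rw [h2, dist_self] at this
      linarith
    have e := hgeq C
    rw [hi] at h2 e
    rw [hinj 0 (h2.trans hS.map_zero_C.symm), chainLine_zero] at e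
    have := lt_one_of_sum_eq_one hp hsum 0
    have e' : (1 - p 0) * g C = 0 := by linarith
    exact (mul_eq_zero.1 e').resolve_left (by linarith)
  have hgA : g A = 1 := by
    obtain ⟨h1, h2⟩ := hισ A hS.memA
    have hi : ι A = 2 := by
      by_contra hi
      have := hlowA _ hi _ h1
      rw [h2, dist_self] at this
      linarith
    have e := hgeq A
    rw [hi] at h2 e
    rw [hinj 2 (h2.trans hS.map_two_C.symm), hgC] at e
    simpa using e
  obtain ⟨L, hL, h01⟩ := hg.zero_one
  obtain ⟨L', hL', h12⟩ := hg.one_two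
  obtain ⟨δ, hδ, h02⟩ := hg.zero_two
  -- A point has two addresses only at a joint: if `S 0 x = S 1 y`, the spreading bound places it at
  -- `S 0 A`, so `x = A` and `y = C`, where the two interval maps agree.
  have k01 : ∀ x ∈ K, ∀ y ∈ K, S 0 x = S 1 y →
      chainLine p 0 (g x) = chainLine p 1 (g y) := fun x hx y hy h => by
    obtain ⟨e1, e2⟩ := h01 x hx y hy
    rw [h, dist_self, mul_zero] at e1 e2
    have e3 := dist_le_zero.1 e1
    have hx' := hinj 0 (h.trans e3)
    have hy' := hinj 1 (e3.trans hS.map_one_C.symm)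
    rw [hx', hy', hgA, hgC]; simp
  have k12 : ∀ x ∈ K, ∀ y ∈ K, S 1 x = S 2 y →
      chainLine p 1 (g x) = chainLine p 2 (g y) := fun x hx y hy h => by
    obtain ⟨e1, e2⟩ := h12 x hx y hy
    rw [h, dist_self, mul_zero] at e1 e2
    have e3 := dist_le_zero.1 e1
    have hx' := hinj 1 (h.trans e3)
    have hy' := hinj 2 (e3.trans hS.map_two_A.symm)
    rw [hx', hy', hgA]; simp; linarith
  have k02 : ∀ x ∈ K, ∀ y ∈ K, S 0 x ≠ S 2 y := fun x hx y hy h => by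
    have := h02 x hx y hy
    rw [h, dist_self] at this
    linarith
  refine ⟨g, fun x _ => hmem x, hgC, hgA, fun i x hx => ?_⟩
  rw [hgeq (S i x)]
  obtain ⟨h1, h2⟩ := hισ (S i x) (hS.map_mem i hx)
  generalize ι (S i x) = j at *
  generalize σ (S i x) = y at *
  by_cases hij : j = i
  · subst hij; rw [hinj j h2]
  · fin_cases i <;> fin_cases j
    · exact absurd rfl hij
    · exact (k01 x hx y h1 h2.symm).symm
    · exact absurd h2.symm (k02 x hx y h1)
    · exact k01 y h1 x hx h2
    · exact absurd rfl hij
    · exact (k12 x hx y h1 h2.symm).symm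
    · exact absurd h2 (k02 y h1 x hx)
    · exact k12 y h1 x hx h2
    · exact absurd rfl hij

lemma holderOnWith_of_dist_le {β : Type*} [MetricSpace β] {f : α → β} {B r : NNReal}
    (h : ∀ x ∈ K, ∀ y ∈ K, dist (f x) (f y) ≤ B * dist x y ^ (r : ℝ)) :
    HolderOnWith B r f K := fun x hx y hy => by
  have h' := ENNReal.ofReal_le_ofReal (h x hx y hy)
  rwa [ENNReal.ofReal_mul B.coe_nonneg, ← ENNReal.ofReal_rpow_of_nonneg dist_nonneg r.coe_nonneg,
    ← edist_dist, ← edist_dist, ENNReal.ofReal_coe_nnreal] at h'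

/-- The dimension of a self-similar chain. -/
theorem IsChain.dimH_eq (hS : IsChain S c K A C) (hK : IsCompact K)
    (hd : ∀ i x y, dist (S i x) (S i y) = c i * dist x y)
    (hg : IsChainGauge S c K A C dist) {s : ℝ} (hs : 0 < s)
    (hsum : c 0 ^ s + c 1 ^ s + c 2 ^ s = 1) : dimH K = ENNReal.ofReal s := by
  let p : Fin 3 → ℝ := fun i => c i ^ s
  have hp : ∀ i, 0 < p i := fun i => Real.rpow_pos_of_pos (hS.pos i) s
  have hpe : ∀ i, p i ^ s⁻¹ = c i := fun i => Real.rpow_rpow_inv (hS.pos i).le hs.ne'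
  obtain ⟨g, hmem, hgC, hgA, hgS⟩ := hS.exists_address hd hg hp hsum
  have hgauge := isChainGauge_address hS hp hsum (inv_pos.2 hs) hpe hmem hgC hgA hgS
  obtain ⟨B, hB, hle⟩ := hg.exists_le hS hgauge
  obtain ⟨B', hB', hge⟩ := hgauge.exists_le hS hg
  have : Nonempty α := ⟨C⟩
  lift B to NNReal using hB
  lift B' to NNReal using hB'
  lift s to NNReal using hs.le
  have hs' : 0 < s := by exact_mod_cast hs
  have hholder : HolderOnWith (B' ^ (s : ℝ)) s g K := holderOnWith_of_dist_le fun x hx y hy => by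
    have h := Real.rpow_le_rpow (by positivity) (hge x hx y hy) hs.le
    rwa [Real.rpow_inv_rpow (abs_nonneg _) hs.ne', Real.mul_rpow B'.coe_nonneg dist_nonneg] at h
  -- Surjectivity: the image of `K` is compact and mapped into itself by the interval maps, and `[0,
  -- 1]` is covered by its own three images, so `subset_of_invariant` applies.
  have himage : g '' K = Icc 0 1 := by
    have hq1 : max (p 0) (max (p 1) (p 2)) < 1 := by
      have := lt_one_of_sum_eq_one hp hsum
      exact max_lt (this 0) (max_lt (this 1) (this 2))
    have hlip : ∀ i x y, dist (chainLine p i x) (chainLine p i y) ≤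
        max (p 0) (max (p 1) (p 2)) * dist x y := fun i x y => by
      rw [Real.dist_eq, abs_chainLine_sub hp, ← Real.dist_eq]
      refine mul_le_mul_of_nonneg_right ?_ dist_nonneg
      fin_cases i <;> simp
    refine Subset.antisymm (image_subset_iff.2 hmem) ?_
    refine subset_of_invariant hq1 hlip (hK.image_of_continuousOn (hholder.continuousOn hs'))
      ⟨g C, C, hS.memC, rfl⟩ ?_ isCompact_Icc ?_
    · rintro i _ ⟨_, ⟨x, hx, rfl⟩, rfl⟩
      exact ⟨S i x, hS.map_mem i hx, hgS i x hx⟩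
    · intro t ht
      have h0 := hp 0
      have h1 := hp 1
      have h2 := hp 2
      rw [mem_iUnion]
      rcases le_total t (p 0) with h | h
      · exact ⟨0, t / p 0, ⟨by have := ht.1; positivity, (div_le_one h0).2 h⟩, by
          rw [chainLine_zero]; field_simp⟩
      rcases le_total t (p 0 + p 1) with h' | h'
      · exact ⟨1, (t - p 0) / p 1, ⟨div_nonneg (by linarith) h1.le,
          (div_le_one h1).2 (by linarith)⟩, by rw [chainLine_one]; field_simp; ring⟩
      · refine ⟨2, (1 - t) / p 2, ⟨div_nonneg (by linarith [ht.2]) h2.le,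
          (div_le_one h2).2 ?_⟩, by rw [chainLine_two]; field_simp; ring⟩
        change p 0 + p 1 + p 2 = 1 at hsum
        linarith
  have hIcc : dimH (Icc (0 : ℝ) 1) = 1 := by
    have h := Real.dimH_of_mem_nhds (E := ℝ) (x := 1 / 2) (s := Icc (0 : ℝ) 1)
      (Icc_mem_nhds (by norm_num) (by norm_num))
    simpa using h
  rw [ENNReal.ofReal_coe_nnreal]
  apply le_antisymm
  · have hinj : InjOn g K := fun x hx y hy hxy => by
      have := hle x hx y hy
      rw [hxy, sub_self, abs_zero, Real.zero_rpow (inv_pos.2 hs).ne', mul_zero] at this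
      exact dist_le_zero.1 this
    have hK' : Function.invFunOn g K '' Icc 0 1 = K := by
      rw [← himage, ← image_comp]
      exact (image_congr fun x hx => hinj.leftInvOn_invFunOn hx).trans (image_id K)
    have : HolderOnWith B s⁻¹ (Function.invFunOn g K) (Icc 0 1) := by
      refine holderOnWith_of_dist_le fun t ht u hu => ?_
      rw [← himage] at ht hu
      have h := hle _ (Function.invFunOn_mem ht) _ (Function.invFunOn_mem hu)
      rw [Function.invFunOn_eq ht, Function.invFunOn_eq hu] at h
      rw [Real.dist_eq, NNReal.coe_inv]
      exact h
    have h := this.dimH_image_le (inv_pos.2 hs')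
    rw [hK', hIcc, ENNReal.coe_inv hs'.ne'] at h
    simpa using h
  · have h := hholder.dimH_image_le hs'
    rw [himage, hIcc] at h
    rw [ENNReal.le_div_iff_mul_le (Or.inl (by simpa using hs'.ne')) (Or.inl (by simp))] at h
    simpa using h

end Dimension

/-! ### Cutting polygons: symmetry and a criterion for two pieces -/

section Subdivision

/-- The other orientation. -/
def RhombusType.swap : RhombusType → RhombusType
  | .horizontal => .vertical
  | .vertical => .horizontal

lemma rhombusTypeAt_succ (k : ℕ) : rhombusTypeAt (k + 1) = (rhombusTypeAt k).swap := by
  unfold rhombusTypeAt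
  by_cases h : Even k
  · simp [h, Nat.even_add_one, RhombusType.swap]
  · simp [h, Nat.even_add_one, RhombusType.swap]

/-- The polygons obtained from `P` by removing a largest rhombus. -/
def subdivide (a : ℝ) (o : RhombusType) (P : Set Plane) : Set (Set Plane) :=
  {Q | ∃ (c : Plane) (h : ℝ), IsLargestRhombus a o P c h ∧
    ∃ x ∈ P \ rhombus a o c h, Q = closure (connectedComponentIn (P \ rhombus a o c h) x)}

/-- The union of the polygons obtained from `P` after `n` iterations, starting with
orientation `o`. -/
def descent (a : ℝ) : RhombusType → ℕ → Set Plane → Set Plane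
  | _, 0, P => P
  | o, n + 1, P => ⋃ Q ∈ subdivide a o P, descent a o.swap n Q

lemma descent_zero (a : ℝ) (o : RhombusType) (P : Set Plane) : descent a o 0 P = P := rfl

lemma descent_succ (a : ℝ) (o : RhombusType) (n : ℕ) (P : Set Plane) :
    descent a o (n + 1) P = ⋃ Q ∈ subdivide a o P, descent a o.swap n Q := rfl

lemma mem_emptyPolygons_succ {a : ℝ} {k : ℕ} {Q : Set Plane} : Q ∈ emptyPolygons a (k + 1) ↔
    ∃ P ∈ emptyPolygons a k, Q ∈ subdivide a (rhombusTypeAt (k + 1)) P := Iff.rfl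

/-- The construction recurses on the last cut; this turns it into a recursion on the first cut, so
that each polygon can be followed separately. -/
lemma iterate_add (a : ℝ) (n k : ℕ) : iterate a (k + n) =
    ⋃ P ∈ emptyPolygons a k, descent a (rhombusTypeAt (k + 1)) n P := by
  induction n generalizing k with
  | zero => simp [iterate, descent_zero, sUnion_eq_biUnion]
  | succ n ih =>
    rw [show k + (n + 1) = (k + 1) + n by ring, ih]
    ext x
    simp only [descent_succ, mem_iUnion, mem_emptyPolygons_succ, exists_prop,
      rhombusTypeAt_succ (k + 1)]
    constructor
    · rintro ⟨Q, ⟨P, hP, hQ⟩, hx⟩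
      exact ⟨P, hP, Q, hQ, hx⟩
    · rintro ⟨P, hP, Q, hQ, hx⟩
      exact ⟨Q, ⟨P, hP, hQ⟩, hx⟩

lemma iterate_eq_descent (a : ℝ) (n : ℕ) :
    iterate a n = descent a .vertical n (rhombus a .horizontal 0 1) := by
  have h := iterate_add a n 0
  rw [zero_add] at h
  rw [h]
  simp [emptyPolygons, rhombusTypeAt]

/-- A homeomorphism that takes rhombi of size `h` and type `o` to rhombi of size `ρ * h` and
type `σ o`. -/
structure IsRhombic (a : ℝ) (f : Plane ≃ₜ Plane) (ρ : ℝ) (σ : RhombusType → RhombusType) :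
    Prop where
  pos : 0 < ρ
  swap : ∀ o, σ o.swap = (σ o).swap
  mem_iff : ∀ o c h p, f p ∈ rhombus a (σ o) (f c) (ρ * h) ↔ p ∈ rhombus a o c h

variable {a ρ ρ' : ℝ} {f f' : Plane ≃ₜ Plane} {σ σ' : RhombusType → RhombusType}

lemma IsRhombic.trans (hf : IsRhombic a f ρ σ) (hf' : IsRhombic a f' ρ' σ') :
    IsRhombic a (f.trans f') (ρ' * ρ) (σ' ∘ σ) where
  pos := mul_pos hf'.pos hf.pos
  swap o := by simp [hf.swap, hf'.swap]
  mem_iff o c h p := by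
    rw [mul_assoc]
    exact (hf'.mem_iff _ _ _ _).trans (hf.mem_iff _ _ _ _)

lemma IsRhombic.image_rhombus (hf : IsRhombic a f ρ σ) (o : RhombusType) (c : Plane) (h : ℝ) :
    f '' rhombus a o c h = rhombus a (σ o) (f c) (ρ * h) := by
  ext p
  obtain ⟨q, rfl⟩ := f.surjective p
  rw [hf.mem_iff, f.injective.mem_set_image]

lemma IsRhombic.isLargestRhombus_iff (hf : IsRhombic a f ρ σ) (o : RhombusType) (P : Set Plane)
    (c : Plane) (h : ℝ) :
    IsLargestRhombus a (σ o) (f '' P) (f c) (ρ * h) ↔ IsLargestRhombus a o P c h := by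
  unfold IsLargestRhombus
  rw [← hf.image_rhombus, image_subset_image_iff f.injective, mul_pos_iff_of_pos_left hf.pos]
  refine and_congr Iff.rfl (and_congr Iff.rfl ⟨fun H c' h' hs => ?_, fun H c' h' hs => ?_⟩)
  · have := H (f c') (ρ * h') (by rwa [← hf.image_rhombus, image_subset_image_iff f.injective])
    exact le_of_mul_le_mul_left this hf.pos
  · obtain ⟨c', rfl⟩ := f.surjective c'
    obtain ⟨h', rfl⟩ : ∃ k, h' = ρ * k := ⟨h' / ρ, by rw [mul_div_cancel₀ _ hf.pos.ne']⟩
    rw [← hf.image_rhombus, image_subset_image_iff f.injective] at hs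
    exact mul_le_mul_of_nonneg_left (H c' h' hs) hf.pos.le

lemma IsRhombic.subdivide_image (hf : IsRhombic a f ρ σ) (o : RhombusType) (P : Set Plane) :
    subdivide a (σ o) (f '' P) = image f '' subdivide a o P := by
  have key : ∀ (c : Plane) (h : ℝ), f '' P \ rhombus a (σ o) (f c) (ρ * h) =
      f '' (P \ rhombus a o c h) := fun c h => by
    rw [← hf.image_rhombus, image_sdiff f.injective]
  ext Q
  constructor
  · rintro ⟨c, h, hl, x, hx, rfl⟩
    obtain ⟨c, rfl⟩ := f.surjective c
    obtain ⟨h, rfl⟩ : ∃ k, h = ρ * k := ⟨h / ρ, by rw [mul_div_cancel₀ _ hf.pos.ne']⟩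
    rw [key] at hx ⊢
    obtain ⟨x, hx, rfl⟩ := hx
    refine ⟨_, ⟨c, h, (hf.isLargestRhombus_iff o P c h).1 hl, x, hx, rfl⟩, ?_⟩
    rw [f.image_closure, f.image_connectedComponentIn hx]
  · rintro ⟨_, ⟨c, h, hl, x, hx, rfl⟩, rfl⟩
    refine ⟨f c, ρ * h, (hf.isLargestRhombus_iff o P c h).2 hl, f x, ?_, ?_⟩
    · rw [key]; exact mem_image_of_mem f hx
    · rw [key, f.image_closure, f.image_connectedComponentIn hx]

/-- Largest rhombi, components and closures are all transported by `f`, so cuts need computing only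
for one polygon of each shape. -/
lemma IsRhombic.descent_image (hf : IsRhombic a f ρ σ) (o : RhombusType) (n : ℕ) (P : Set Plane) :
    descent a (σ o) n (f '' P) = f '' descent a o n P := by
  induction n generalizing o P with
  | zero => rfl
  | succ n ih =>
    rw [descent_succ, descent_succ, hf.subdivide_image, biUnion_image, image_iUnion₂]
    refine iUnion₂_congr fun Q _ => ?_
    rw [← hf.swap, ih]

/-- A set that is star-shaped towards `e` is connected, and its closure is any closed set that the
segments towards `e` start from. -/
lemma closure_eq_and_isPreconnected_of_star {Q Q' : Set Plane} {e : Plane} (hQ : IsClosed Q)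
    (hsub : Q' ⊆ Q) (he : e ∈ Q')
    (hstar : ∀ p ∈ Q, ∀ t : ℝ, 0 < t → t ≤ 1 → (1 - t) • p + t • e ∈ Q') :
    closure Q' = Q ∧ IsPreconnected Q' := by
  constructor
  · refine Subset.antisymm (closure_minimal hsub hQ) fun p hp => ?_
    have hc : Continuous fun t : ℝ => (1 - t) • p + t • e := by fun_prop
    have hlim : Tendsto (fun n : ℕ => (1 - 1 / ((n : ℝ) + 1)) • p + (1 / ((n : ℝ) + 1)) • e)
        atTop (𝓝 p) := by
      have := (hc.tendsto 0).comp tendsto_one_div_add_atTop_nhds_zero_nat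
      rw [sub_zero, one_smul, zero_smul, add_zero] at this
      exact this
    refine mem_closure_of_tendsto hlim (Eventually.of_forall fun n => hstar p hp _ ?_ ?_)
    · positivity
    · rw [div_le_one (by positivity)]; linarith [(Nat.cast_nonneg n : (0 : ℝ) ≤ n)]
  · have : StarConvex ℝ e Q' := by
      intro y hy u v hu hv huv
      rcases hu.eq_or_lt with rfl | hu
      · rw [zero_add] at huv
        simpa [huv] using hy
      · have := hstar y (hsub hy) u hu (by linarith)
        rwa [show 1 - u = v by linarith, add_comm] at this
    exact (this.isPathConnected he).isConnected.isPreconnected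

/-- Criterion for a polygon to be cut into two pieces by its unique largest rhombus. -/
lemma subdivide_eq_pair {a : ℝ} {o : RhombusType} {P Q₁ Q₂ : Set Plane} {c e₁ e₂ : Plane} {h : ℝ}
    (hh : 0 < h) (hsub : rhombus a o c h ⊆ P)
    (hmax : ∀ c' h', 0 ≤ h' → rhombus a o c' h' ⊆ P → h' ≤ h ∧ (h' = h → c' = c))
    {φ : Plane → ℝ} (hφ : Continuous φ) (hφ0 : ∀ p ∈ P, φ p = 0 → p ∈ rhombus a o c h)
    (hQ₁ : IsClosed Q₁) (hQ₂ : IsClosed Q₂)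
    (hs₁ : ∀ p ∈ P, p ∉ rhombus a o c h → φ p < 0 → p ∈ Q₁)
    (hs₂ : ∀ p ∈ P, p ∉ rhombus a o c h → 0 < φ p → p ∈ Q₂)
    (he₁ : e₁ ∈ Q₁) (he₂ : e₂ ∈ Q₂)
    (hstar₁ : ∀ p ∈ Q₁, ∀ t : ℝ, 0 < t → t ≤ 1 → (1 - t) • p + t • e₁ ∈ P ∧
      (1 - t) • p + t • e₁ ∉ rhombus a o c h ∧ φ ((1 - t) • p + t • e₁) < 0)
    (hstar₂ : ∀ p ∈ Q₂, ∀ t : ℝ, 0 < t → t ≤ 1 → (1 - t) • p + t • e₂ ∈ P ∧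
      (1 - t) • p + t • e₂ ∉ rhombus a o c h ∧ 0 < φ ((1 - t) • p + t • e₂)) :
    subdivide a o P = {Q₁, Q₂} := by
  set D := P \ rhombus a o c h with hD
  have hlargest : IsLargestRhombus a o P c h := by
    refine ⟨hh, hsub, fun c' h' hs => ?_⟩
    by_cases h0 : 0 ≤ h'
    · exact (hmax c' h' h0 hs).1
    · linarith
  -- `subdivide` ranges over every largest rhombus; the equality case of `hmax` leaves just one.
  have huniq : ∀ c' h', IsLargestRhombus a o P c' h' → c' = c ∧ h' = h := fun c' h' H => by
    have h1 := hmax c' h' H.1.le H.2.1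
    have h2 := H.2.2 c h hsub
    have h3 := le_antisymm h1.1 h2
    exact ⟨h1.2 h3, h3⟩
  have hone₁ : e₁ ∈ D ∩ {p | φ p < 0} := by
    have := hstar₁ e₁ he₁ 1 one_pos le_rfl
    simp only [sub_self, zero_smul, one_smul, zero_add] at this
    exact ⟨⟨this.1, this.2.1⟩, this.2.2⟩
  have hone₂ : e₂ ∈ D ∩ {p | 0 < φ p} := by
    have := hstar₂ e₂ he₂ 1 one_pos le_rfl
    simp only [sub_self, zero_smul, one_smul, zero_add] at this
    exact ⟨⟨this.1, this.2.1⟩, this.2.2⟩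
  obtain ⟨hcl₁, hpre₁⟩ := closure_eq_and_isPreconnected_of_star hQ₁
    (Q' := D ∩ {p | φ p < 0}) (fun p hp => hs₁ p hp.1.1 hp.1.2 hp.2) hone₁
    fun p hp t h0 h1 => by
      obtain ⟨k1, k2, k3⟩ := hstar₁ p hp t h0 h1
      exact ⟨⟨k1, k2⟩, k3⟩
  obtain ⟨hcl₂, hpre₂⟩ := closure_eq_and_isPreconnected_of_star hQ₂
    (Q' := D ∩ {p | 0 < φ p}) (fun p hp => hs₂ p hp.1.1 hp.1.2 hp.2) hone₂
    fun p hp t h0 h1 => by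
      obtain ⟨k1, k2, k3⟩ := hstar₂ p hp t h0 h1
      exact ⟨⟨k1, k2⟩, k3⟩
  have hopen₁ : IsOpen {p | φ p < 0} := isOpen_lt hφ continuous_const
  have hopen₂ : IsOpen {p | 0 < φ p} := isOpen_lt continuous_const hφ
  have hdisj : Disjoint {p | φ p < 0} {p | 0 < φ p} :=
    disjoint_left.2 fun p (h1 : φ p < 0) (h2 : 0 < φ p) => lt_asymm h1 h2
  -- The removed rhombus contains the zero set of `φ` in `P`, so the rest splits by the sign of `φ`
  -- into two relatively open parts. Each is star-shaped, hence connected, hence a component.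
  have hcov : D ⊆ {p | φ p < 0} ∪ {p | 0 < φ p} := fun p hp =>
    lt_or_gt_of_ne fun h0 => hp.2 (hφ0 p hp.1 h0)
  have hcomp₁ : ∀ x ∈ D, φ x < 0 → connectedComponentIn D x = D ∩ {p | φ p < 0} := fun x hx h0 =>
    Subset.antisymm (subset_inter (connectedComponentIn_subset _ _)
      (isPreconnected_connectedComponentIn.subset_left_of_subset_union hopen₁ hopen₂ hdisj
        ((connectedComponentIn_subset _ _).trans hcov) ⟨x, mem_connectedComponentIn hx, h0⟩))
      (hpre₁.subset_connectedComponentIn ⟨hx, h0⟩ inter_subset_left)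
  have hcomp₂ : ∀ x ∈ D, 0 < φ x → connectedComponentIn D x = D ∩ {p | 0 < φ p} := fun x hx h0 =>
    Subset.antisymm (subset_inter (connectedComponentIn_subset _ _)
      (isPreconnected_connectedComponentIn.subset_right_of_subset_union hopen₁ hopen₂ hdisj
        ((connectedComponentIn_subset _ _).trans hcov) ⟨x, mem_connectedComponentIn hx, h0⟩))
      (hpre₂.subset_connectedComponentIn ⟨hx, h0⟩ inter_subset_left)
  ext Q
  rw [mem_insert_iff, mem_singleton_iff]
  constructor
  · rintro ⟨c', h', hl, x, hx, rfl⟩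
    obtain ⟨rfl, rfl⟩ := huniq c' h' hl
    rcases hcov hx with h0 | h0
    · left; rw [← hD, hcomp₁ x hx h0, hcl₁]
    · right; rw [← hD, hcomp₂ x hx h0, hcl₂]
  · rintro (rfl | rfl)
    · exact ⟨c, h, hlargest, e₁, hone₁.1, by rw [← hD, hcomp₁ e₁ hone₁.1 hone₁.2, hcl₁]⟩
    · exact ⟨c, h, hlargest, e₂, hone₂.1, by rw [← hD, hcomp₂ e₂ hone₂.1 hone₂.2, hcl₂]⟩

end Subdivision

/-! ### The similarities, the dart and the triangle -/

section Geometry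

@[ext] lemma Plane.ext {p q : Plane} (h0 : p 0 = q 0) (h1 : p 1 = q 1) : p = q := by
  ext i; fin_cases i
  · exact h0
  · exact h1

/-- The map `(x, y) ↦ (u + α x, v + β y)`. -/
noncomputable def diagHomeo (α β u v : ℝ) (hα : α ≠ 0) (hβ : β ≠ 0) : Plane ≃ₜ Plane where
  toFun p := !₂[u + α * p 0, v + β * p 1]
  invFun p := !₂[(p 0 - u) / α, (p 1 - v) / β]
  left_inv p := by ext <;> simp <;> field_simp
  right_inv p := by ext <;> simp <;> field_simp <;> ring
  continuous_toFun := by fun_prop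
  continuous_invFun := by fun_prop

/-- The exchange of the coordinates. -/
noncomputable def swapHomeo : Plane ≃ₜ Plane where
  toFun p := !₂[p 1, p 0]
  invFun p := !₂[p 1, p 0]
  left_inv p := by ext <;> simp
  right_inv p := by ext <;> simp
  continuous_toFun := by fun_prop
  continuous_invFun := by fun_prop

lemma diagHomeo_apply {α β u v : ℝ} (hα : α ≠ 0) (hβ : β ≠ 0) (p : Plane) :
    diagHomeo α β u v hα hβ p = !₂[u + α * p 0, v + β * p 1] := rfl

lemma swapHomeo_apply (p : Plane) : swapHomeo p = !₂[p 1, p 0] := rfl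

lemma isRhombic_diagHomeo (a : ℝ) {α β u v ρ : ℝ} (hα : α ≠ 0) (hβ : β ≠ 0) (hρ : 0 < ρ)
    (hα' : |α| = ρ) (hβ' : |β| = ρ) : IsRhombic a (diagHomeo α β u v hα hβ) ρ id where
  pos := hρ
  swap _ := rfl
  mem_iff o c h p := by
    have h0 : |u + α * p 0 - (u + α * c 0)| = ρ * |p 0 - c 0| := by
      rw [← hα', ← abs_mul]; congr 1; ring
    have h1 : |v + β * p 1 - (v + β * c 1)| = ρ * |p 1 - c 1| := by
      rw [← hβ', ← abs_mul]; congr 1; ring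
    cases o
    · change a * |u + α * p 0 - (u + α * c 0)| + |v + β * p 1 - (v + β * c 1)| ≤ ρ * h ↔
        a * |p 0 - c 0| + |p 1 - c 1| ≤ h
      rw [h0, h1, ← mul_le_mul_iff_right₀ hρ (b := a * |p 0 - c 0| + |p 1 - c 1|)]
      ring_nf
    · change |u + α * p 0 - (u + α * c 0)| + a * |v + β * p 1 - (v + β * c 1)| ≤ ρ * h ↔
        |p 0 - c 0| + a * |p 1 - c 1| ≤ h
      rw [h0, h1, ← mul_le_mul_iff_right₀ hρ (b := |p 0 - c 0| + a * |p 1 - c 1|)]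
      ring_nf

lemma isRhombic_swapHomeo (a : ℝ) : IsRhombic a swapHomeo 1 RhombusType.swap where
  pos := one_pos
  swap _ := rfl
  mem_iff o c h p := by
    rw [one_mul]
    cases o
    · change |p 1 - c 1| + a * |p 0 - c 0| ≤ h ↔ a * |p 0 - c 0| + |p 1 - c 1| ≤ h
      rw [add_comm]
    · change a * |p 1 - c 1| + |p 0 - c 0| ≤ h ↔ |p 0 - c 0| + a * |p 1 - c 1| ≤ h
      rw [add_comm]

/-- The reflection in the vertical axis. -/
noncomputable def reflX : Plane ≃ₜ Plane := diagHomeo (-1) 1 0 0 (by norm_num) (by norm_num)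

/-- The reflection in the horizontal axis. -/
noncomputable def reflY : Plane ≃ₜ Plane := diagHomeo 1 (-1) 0 0 (by norm_num) (by norm_num)

@[simp] lemma reflX_apply (p : Plane) : reflX p = !₂[-p 0, p 1] := by
  ext <;> simp [reflX, diagHomeo_apply]

@[simp] lemma reflY_apply (p : Plane) : reflY p = !₂[p 0, -p 1] := by
  ext <;> simp [reflY, diagHomeo_apply]

lemma isRhombic_reflX (a : ℝ) : IsRhombic a reflX 1 id :=
  isRhombic_diagHomeo a _ _ one_pos (by norm_num) (by norm_num)

lemma isRhombic_reflY (a : ℝ) : IsRhombic a reflY 1 id :=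
  isRhombic_diagHomeo a _ _ one_pos (by norm_num) (by norm_num)

/-- The ratio of the two smaller similarities. -/
noncomputable def ratio (a : ℝ) : ℝ := (1 - a ^ 2) / 2

/-- The three similarities. -/
noncomputable def pieceMap (a : ℝ) : Fin 3 → Plane → Plane :=
  ![fun p => !₂[a * (1 - p 1), 1 - a * p 0],
    fun p => !₂[a + ratio a * p 0, ratio a + ratio a * p 1],
    fun p => !₂[a + ratio a * p 0, ratio a - ratio a * p 1]]

variable {a : ℝ}

@[simp] lemma pieceMap_zero_zero (p : Plane) : pieceMap a 0 p 0 = a * (1 - p 1) := rfl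
@[simp] lemma pieceMap_zero_one (p : Plane) : pieceMap a 0 p 1 = 1 - a * p 0 := rfl
@[simp] lemma pieceMap_one_zero (p : Plane) : pieceMap a 1 p 0 = a + ratio a * p 0 := rfl
@[simp] lemma pieceMap_one_one (p : Plane) : pieceMap a 1 p 1 = ratio a + ratio a * p 1 := rfl
@[simp] lemma pieceMap_two_zero (p : Plane) : pieceMap a 2 p 0 = a + ratio a * p 0 := rfl
@[simp] lemma pieceMap_two_one (p : Plane) : pieceMap a 2 p 1 = ratio a - ratio a * p 1 := rfl

lemma ratio_pos (ha0 : 0 < a) (ha1 : a < 1) : 0 < ratio a := by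
  unfold ratio; nlinarith

/-- The dart splits into a triangle and its mirror image, so one small dart yields both pieces 1 and
2. -/
lemma pieceMap_two_eq (p : Plane) : pieceMap a 2 p = pieceMap a 1 (reflY p) := by
  ext <;> simp; ring

/-- `swap` fits the alternation: the copy of the triangle left by a vertical cut is cut horizontally
next. The map of `exists_homeo_one` keeps orientations, because it carries a dart, which is itself
due for a horizontal cut. -/
lemma exists_homeo_zero (ha0 : 0 < a) :
    ∃ f : Plane ≃ₜ Plane, ⇑f = pieceMap a 0 ∧ IsRhombic a f a RhombusType.swap := by
  have hne : -a ≠ 0 := by linarith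
  have habs : |(-a)| = a := by rw [abs_neg, abs_of_pos ha0]
  refine ⟨swapHomeo.trans (diagHomeo (-a) (-a) a 1 hne hne), ?_, ?_⟩
  · funext p
    ext <;> simp [diagHomeo_apply, swapHomeo_apply] <;> ring
  · simpa using (isRhombic_swapHomeo a).trans (isRhombic_diagHomeo a hne hne ha0 habs habs)

lemma exists_homeo_one (ha0 : 0 < a) (ha1 : a < 1) :
    ∃ f : Plane ≃ₜ Plane, ⇑f = pieceMap a 1 ∧ IsRhombic a f (ratio a) id := by
  have hr := ratio_pos ha0 ha1
  exact ⟨diagHomeo (ratio a) (ratio a) a (ratio a) hr.ne' hr.ne', rfl,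
    isRhombic_diagHomeo a _ _ hr (abs_of_pos hr) (abs_of_pos hr)⟩

lemma exists_homeo (ha0 : 0 < a) (ha1 : a < 1) (i : Fin 3) :
    ∃ f : Plane ≃ₜ Plane, ⇑f = pieceMap a i := by
  fin_cases i
  · exact (exists_homeo_zero ha0).imp fun f hf => hf.1
  · exact (exists_homeo_one ha0 ha1).imp fun f hf => hf.1
  · obtain ⟨f, hf, -⟩ := exists_homeo_one ha0 ha1
    refine ⟨reflY.trans f, ?_⟩
    funext p
    exact (congrFun hf _).trans (pieceMap_two_eq p).symm

/-- The right-hand empty polygon at iteration 1. -/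
def dart (a : ℝ) : Set Plane := {p | a * p 0 + |p 1| ≤ 1 ∧ a ≤ p 0 + a * |p 1|}

/-- The upper-right empty polygon at iteration 2. -/
def triangle (a : ℝ) : Set Plane :=
  {p | a * p 0 + p 1 ≤ 1 ∧ a ≤ p 0 + a * p 1 ∧ a * (p 0 - a) ≤ p 1}

lemma mem_dart {p : Plane} : p ∈ dart a ↔ a * p 0 + |p 1| ≤ 1 ∧ a ≤ p 0 + a * |p 1| := Iff.rfl

lemma mem_triangle {p : Plane} : p ∈ triangle a ↔
    a * p 0 + p 1 ≤ 1 ∧ a ≤ p 0 + a * p 1 ∧ a * (p 0 - a) ≤ p 1 := Iff.rfl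

lemma isClosed_dart : IsClosed (dart a) :=
  (isClosed_le (by fun_prop) (by fun_prop)).and (isClosed_le (by fun_prop) (by fun_prop))

lemma isClosed_triangle : IsClosed (triangle a) :=
  (isClosed_le (by fun_prop) (by fun_prop)).and
    ((isClosed_le (by fun_prop) (by fun_prop)).and (isClosed_le (by fun_prop) (by fun_prop)))

lemma nonneg_of_mem_dart (ha0 : 0 < a) (ha1 : a < 1) {p : Plane} (hp : p ∈ dart a) : 0 ≤ p 0 := by
  obtain ⟨h1, h2⟩ := hp
  have h3 : 0 ≤ (1 - a ^ 2) * p 0 := by nlinarith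
  exact nonneg_of_mul_nonneg_right h3 (by nlinarith)

lemma nonneg_of_mem_triangle (ha0 : 0 < a) {p : Plane} (hp : p ∈ triangle a) : 0 ≤ p 1 := by
  obtain ⟨h1, h2, h3⟩ := hp
  nlinarith [sq_nonneg a]

/-- The triangle lies in an upward cone with apex `A`, so height controls the distance to `A`. This
provides the linear spreading at the joints. -/
lemma abs_sub_le_of_mem_triangle (ha0 : 0 < a) (ha1 : a < 1) {p : Plane} (hp : p ∈ triangle a) :
    a * |p 0 - a| ≤ p 1 := by
  have h4 := nonneg_of_mem_triangle ha0 hp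
  obtain ⟨h1, h2, h3⟩ := hp
  have e : a * |p 0 - a| = |a * (p 0 - a)| := by rw [abs_mul, abs_of_pos ha0]
  rw [e, abs_le]
  have h5 : 0 ≤ (1 - a ^ 2) * p 1 := mul_nonneg (by nlinarith) h4
  exact ⟨by linarith [mul_le_mul_of_nonneg_left h2 ha0.le], h3⟩

lemma fst_nonneg_of_mem_triangle (ha0 : 0 < a) (ha1 : a < 1) {p : Plane} (hp : p ∈ triangle a) :
    0 ≤ p 0 := by
  obtain ⟨h1, h2, h3⟩ := hp
  have h : 0 ≤ (1 - a ^ 2) * p 0 := by nlinarith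
  exact nonneg_of_mul_nonneg_right h (by nlinarith)

end Geometry

/-! ### Cutting the initial rhombus and the dart -/

section Cuts

variable {a : ℝ}

lemma mem_rhombus_horizontal {c p : Plane} {h : ℝ} :
    p ∈ rhombus a .horizontal c h ↔ a * |p 0 - c 0| + |p 1 - c 1| ≤ h := Iff.rfl

lemma mem_rhombus_vertical {c p : Plane} {h : ℝ} :
    p ∈ rhombus a .vertical c h ↔ |p 0 - c 0| + a * |p 1 - c 1| ≤ h := Iff.rfl

lemma left_mem_horizontal (ha0 : 0 < a) (c : Plane) {h : ℝ} (hh : 0 ≤ h) :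
    !₂[c 0 - h / a, c 1] ∈ rhombus a .horizontal c h := by
  have : a * |h / a| = h := by rw [abs_of_nonneg (by positivity)]; field_simp
  simp [mem_rhombus_horizontal, this]

lemma right_mem_horizontal (ha0 : 0 < a) (c : Plane) {h : ℝ} (hh : 0 ≤ h) :
    !₂[c 0 + h / a, c 1] ∈ rhombus a .horizontal c h := by
  have : a * |h / a| = h := by rw [abs_of_nonneg (by positivity)]; field_simp
  simp [mem_rhombus_horizontal, this]

lemma left_mem_vertical (c : Plane) {h : ℝ} (hh : 0 ≤ h) :
    !₂[c 0 - h, c 1] ∈ rhombus a .vertical c h := by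
  simp [mem_rhombus_vertical, abs_of_nonneg hh]

lemma top_mem_vertical (ha0 : 0 < a) (c : Plane) {h : ℝ} (hh : 0 ≤ h) :
    !₂[c 0, c 1 + h / a] ∈ rhombus a .vertical c h := by
  have : a * |h / a| = h := by rw [abs_of_nonneg (by positivity)]; field_simp
  simp [mem_rhombus_vertical, this]

lemma bottom_mem_vertical (ha0 : 0 < a) (c : Plane) {h : ℝ} (hh : 0 ≤ h) :
    !₂[c 0, c 1 - h / a] ∈ rhombus a .vertical c h := by
  have : a * |h / a| = h := by rw [abs_of_nonneg (by positivity)]; field_simp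
  simp [mem_rhombus_vertical, this]

lemma mem_image_reflX {P : Set Plane} {p : Plane} : p ∈ reflX '' P ↔ !₂[-p 0, p 1] ∈ P := by
  constructor
  · rintro ⟨q, hq, rfl⟩
    have : !₂[-(reflX q) 0, (reflX q) 1] = q := by ext <;> simp
    rwa [this]
  · intro h
    exact ⟨_, h, by ext <;> simp⟩

lemma mem_image_reflY {P : Set Plane} {p : Plane} : p ∈ reflY '' P ↔ !₂[p 0, -p 1] ∈ P := by
  constructor
  · rintro ⟨q, hq, rfl⟩
    have : !₂[(reflY q) 0, -(reflY q) 1] = q := by ext <;> simp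
    rwa [this]
  · intro h
    exact ⟨_, h, by ext <;> simp⟩

/-- The copy keeps the lines `BC` and `AC`; its third side is on `DG`, an edge of the rhombus `A H G
D`. -/
lemma mem_image_pieceMap_zero_triangle (ha0 : 0 < a) {p : Plane} :
    p ∈ pieceMap a 0 '' triangle a ↔
      a * p 0 + p 1 ≤ 1 ∧ a ≤ p 0 + a * p 1 ∧ p 0 - a * p 1 ≤ a ^ 3 := by
  obtain ⟨f, hf, -⟩ := exists_homeo_zero ha0
  rw [← hf]
  obtain ⟨q, rfl⟩ := f.surjective p
  rw [f.injective.mem_set_image, hf, mem_triangle]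
  simp only [pieceMap_zero_zero, pieceMap_zero_one]
  constructor
  · rintro ⟨h1, h2, h3⟩
    refine ⟨?_, ?_, ?_⟩ <;> nlinarith
  · rintro ⟨h1, h2, h3⟩
    refine ⟨?_, ?_, ?_⟩ <;> refine le_of_mul_le_mul_left ?_ ha0 <;> nlinarith

lemma mem_image_pieceMap_one_dart (ha0 : 0 < a) (ha1 : a < 1) {p : Plane} :
    p ∈ pieceMap a 1 '' dart a ↔ a * (p 0 - a) + |p 1 - ratio a| ≤ ratio a ∧
      a * ratio a ≤ p 0 - a + a * |p 1 - ratio a| := by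
  obtain ⟨f, hf, -⟩ := exists_homeo_one ha0 ha1
  have hr := ratio_pos ha0 ha1
  rw [← hf]
  obtain ⟨q, rfl⟩ := f.surjective p
  rw [f.injective.mem_set_image, hf, mem_dart]
  simp only [pieceMap_one_zero, pieceMap_one_one, add_sub_cancel_left, abs_mul, abs_of_pos hr]
  constructor
  · rintro ⟨h1, h2⟩
    constructor <;> nlinarith
  · rintro ⟨h1, h2⟩
    constructor <;> refine le_of_mul_le_mul_left ?_ hr <;> nlinarith

/-- The top and bottom vertices of a competitor are `2 * h / a` apart inside a set of height `2`, so
`h ≤ a`, and equality forces the centre. The darts are star-shaped about the left and right vertices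
of the initial rhombus. -/
lemma subdivide_rhombus (ha0 : 0 < a) (ha1 : a < 1) :
    subdivide a .vertical (rhombus a .horizontal 0 1) = {reflX '' dart a, dart a} := by
  have hmem : ∀ p : Plane, p ∈ rhombus a .horizontal 0 1 ↔ a * |p 0| + |p 1| ≤ 1 := fun p => by
    simp [mem_rhombus_horizontal]
  have hmem' : ∀ p : Plane, p ∈ rhombus a .vertical 0 a ↔ |p 0| + a * |p 1| ≤ a := fun p => by
    simp [mem_rhombus_vertical]
  have hX : ∀ p : Plane, p ∈ reflX '' dart a ↔ a * -p 0 + |p 1| ≤ 1 ∧ a ≤ -p 0 + a * |p 1| :=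
    fun p => by rw [mem_image_reflX]; simp [mem_dart]
  have h1a : a * a⁻¹ = 1 := mul_inv_cancel₀ ha0.ne'
  have h1a' : 1 < a⁻¹ := (one_lt_inv₀ ha0).2 ha1
  have hneg : ∀ p : Plane, a * -p 0 + |p 1| ≤ 1 ∧ a ≤ -p 0 + a * |p 1| → p 0 ≤ 0 := fun p hp => by
    have := nonneg_of_mem_dart ha0 ha1 (show !₂[-p 0, p 1] ∈ dart a by simpa [mem_dart] using hp)
    simpa using this
  refine subdivide_eq_pair (c := 0) (h := a) (φ := fun p => p 0) (e₁ := !₂[-a⁻¹, 0])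
    (e₂ := !₂[a⁻¹, 0]) ha0 ?_ ?_ (by fun_prop) ?_ ?_ isClosed_dart ?_ ?_ ?_ ?_ ?_ ?_
  · intro p
    rw [hmem, hmem']
    intro h
    have := abs_nonneg (p 0)
    have := abs_nonneg (p 1)
    have h2 : 0 ≤ (1 - a ^ 2) * |p 0| := mul_nonneg (by nlinarith) (abs_nonneg _)
    nlinarith
  · intro c h hh hs
    have h1 := (hmem _).1 (hs (top_mem_vertical ha0 c hh))
    have h2 := (hmem _).1 (hs (bottom_mem_vertical ha0 c hh))
    simp only [Matrix.cons_val_zero, Matrix.cons_val_one] at h1 h2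
    have h3 : 0 ≤ a * |c 0| := by positivity
    have h4 := le_abs_self (c 1 + h / a)
    have h5 := neg_le_abs (c 1 - h / a)
    constructor
    · have : h / a ≤ 1 := by linarith
      rwa [div_le_one ha0] at this
    · intro hha
      rw [hha, div_self ha0.ne'] at h1 h2 h4 h5
      have h6 : a * |c 0| = 0 := by linarith
      have h7 := abs_eq_zero.1 ((mul_eq_zero.1 h6).resolve_left ha0.ne')
      ext
      · simpa using h7
      · simp; linarith
  · intro p hp h0
    rw [hmem] at hp
    rw [hmem']
    simp only [h0, abs_zero] at *
    nlinarith
  · rw [reflX.isClosed_image]; exact isClosed_dart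
  · intro p hp hp' h0
    rw [hmem] at hp
    rw [hmem', not_le] at hp'
    rw [hX]
    rw [abs_of_neg h0] at hp hp'
    exact ⟨hp, hp'.le⟩
  · intro p hp hp' h0
    rw [hmem] at hp
    rw [hmem', not_le] at hp'
    rw [abs_of_pos h0] at hp hp'
    exact ⟨hp, hp'.le⟩
  · rw [hX]; simp [h1a]; linarith
  · rw [mem_dart]; simp [h1a]; linarith
  · intro p hp t ht0 ht1
    rw [hX] at hp
    have hn := hneg p hp
    rw [hmem, hmem', not_le]
    simp only [PiLp.add_apply, PiLp.smul_apply, smul_eq_mul, Matrix.cons_val_zero,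
      Matrix.cons_val_one, mul_zero, add_zero]
    have k0 : (1 - t) * p 0 + t * -a⁻¹ < 0 := by nlinarith
    rw [abs_of_neg k0, abs_mul, abs_of_nonneg (by linarith : 0 ≤ 1 - t)]
    refine ⟨?_, ?_, k0⟩
    · nlinarith [mul_le_mul_of_nonneg_left hp.1 (by linarith : 0 ≤ 1 - t)]
    · nlinarith [mul_le_mul_of_nonneg_left hp.2 (by linarith : 0 ≤ 1 - t)]
  · intro p hp t ht0 ht1
    have hn := nonneg_of_mem_dart ha0 ha1 hp
    rw [mem_dart] at hp
    rw [hmem, hmem', not_le]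
    simp only [PiLp.add_apply, PiLp.smul_apply, smul_eq_mul, Matrix.cons_val_zero,
      Matrix.cons_val_one, mul_zero, add_zero]
    have k0 : 0 < (1 - t) * p 0 + t * a⁻¹ := by nlinarith
    rw [abs_of_pos k0, abs_mul, abs_of_nonneg (by linarith : 0 ≤ 1 - t)]
    refine ⟨?_, ?_, k0⟩
    · nlinarith [mul_le_mul_of_nonneg_left hp.1 (by linarith : 0 ≤ 1 - t)]
    · nlinarith [mul_le_mul_of_nonneg_left hp.2 (by linarith : 0 ≤ 1 - t)]

/-- At height `y` the dart has width `(1 - |y|) * (1 - a ^ 2) / a`, largest only at `y = 0`; so the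
left and right vertices of a competitor bound its size, and `m` is the midpoint of `[a, 1 / a]`. -/
lemma subdivide_dart (ha0 : 0 < a) (ha1 : a < 1) :
    subdivide a .horizontal (dart a) = {reflY '' triangle a, triangle a} := by
  have hr := ratio_pos ha0 ha1
  have hr' : ratio a = (1 - a ^ 2) / 2 := rfl
  set m := (1 + a ^ 2) / (2 * a) with hm
  have ham : a * m = (1 + a ^ 2) / 2 := by rw [hm]; field_simp
  have hm0 : 0 < m := by positivity
  have hmem' : ∀ p : Plane, p ∈ rhombus a .horizontal !₂[m, 0] (ratio a) ↔
      a * |p 0 - m| + |p 1| ≤ ratio a := fun p => by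
    simp [mem_rhombus_horizontal]
  have hY : ∀ p : Plane, p ∈ reflY '' triangle a ↔
      a * p 0 - p 1 ≤ 1 ∧ a ≤ p 0 - a * p 1 ∧ a * (p 0 - a) ≤ -p 1 := fun p => by
    rw [mem_image_reflY]; simp [mem_triangle, sub_eq_add_neg]
  -- The outer edges of the rhombus lie on the boundary of the dart, so escaping it means crossing
  -- `AB` or its mirror image.
  have main : ∀ x y : ℝ, a * x + |y| ≤ 1 → ratio a < a * |x - m| + |y| → a * (x - a) < |y| := by
    intro x y h1 h2
    rcases le_total m x with h | h
    · rw [abs_of_nonneg (by linarith)] at h2; nlinarith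
    · rw [abs_of_nonpos (by linarith)] at h2; nlinarith
  have main' : ∀ x y : ℝ, a * x + y ≤ 1 → a * (x - a) < y → ratio a < a * |x - m| + y := by
    intro x y h1 h2
    have : x < m := by
      refine lt_of_mul_lt_mul_left ?_ ha0.le
      rw [ham]; linarith
    rw [abs_of_neg (by linarith)]; nlinarith
  refine subdivide_eq_pair (c := !₂[m, 0]) (h := ratio a) (φ := fun p => p 1) (e₁ := !₂[0, -1])
    (e₂ := !₂[0, 1]) hr ?_ ?_ (by fun_prop) ?_ ?_ isClosed_triangle ?_ ?_ ?_ ?_ ?_ ?_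
  · intro p
    rw [hmem', mem_dart]
    intro h
    have h0 : 0 ≤ (1 - a ^ 2) * |p 1| := mul_nonneg (by nlinarith) (abs_nonneg _)
    have h1 := le_abs_self (p 0 - m)
    have h2 := neg_le_abs (p 0 - m)
    constructor
    · nlinarith
    · refine le_of_mul_le_mul_left ?_ ha0
      nlinarith [mul_le_mul_of_nonneg_left h2 ha0.le, mul_nonneg (sq_nonneg a) (abs_nonneg (p 1)),
        abs_nonneg (p 1)]
  · intro c h hh hs
    have h1 := hs (left_mem_horizontal ha0 c hh)
    have h2 := hs (right_mem_horizontal ha0 c hh)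
    rw [mem_dart] at h1 h2
    simp only [Matrix.cons_val_zero, Matrix.cons_val_one] at h1 h2
    have e : a * (h / a) = h := by field_simp
    generalize h / a = k at h1 h2 e
    have h3 : 0 ≤ (1 - a ^ 2) * |c 1| := mul_nonneg (by nlinarith) (abs_nonneg _)
    have h4 := mul_le_mul_of_nonneg_left h1.2 ha0.le
    constructor
    · rw [hr']; nlinarith [h2.1]
    · intro hhr
      rw [hhr, hr'] at e
      have h6 : (1 - a ^ 2) * |c 1| = 0 := by nlinarith [h2.1]
      have h7 := abs_eq_zero.1 ((mul_eq_zero.1 h6).resolve_left (by nlinarith))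
      rw [h7, abs_zero] at h1 h2 h4
      ext
      · simp
        refine le_antisymm ?_ ?_ <;> refine le_of_mul_le_mul_left ?_ ha0 <;> nlinarith [h2.1]
      · simpa using h7
  · intro p hp h0
    rw [mem_dart] at hp
    rw [hmem']
    simp only [h0, abs_zero] at *
    rw [hr']
    rcases le_total m (p 0) with h | h
    · rw [abs_of_nonneg (by linarith)]; nlinarith
    · rw [abs_of_nonpos (by linarith)]; nlinarith
  · rw [reflY.isClosed_image]; exact isClosed_triangle
  · intro p hp hp' h0
    rw [mem_dart] at hp
    rw [hmem', not_le] at hp'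
    have := main _ _ hp.1 hp'
    rw [hY]
    rw [abs_of_neg h0] at hp this
    exact ⟨by linarith [hp.1], by linarith [hp.2], this.le⟩
  · intro p hp hp' h0
    rw [mem_dart] at hp
    rw [hmem', not_le] at hp'
    have := main _ _ hp.1 hp'
    rw [abs_of_pos h0] at hp this
    exact ⟨hp.1, hp.2, this.le⟩
  · rw [hY]; simp; nlinarith
  · rw [mem_triangle]; simp; nlinarith
  · intro p hp t ht0 ht1
    rw [hY] at hp
    rw [mem_dart, hmem', not_le]
    simp only [PiLp.add_apply, PiLp.smul_apply, smul_eq_mul, Matrix.cons_val_zero,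
      Matrix.cons_val_one, mul_zero, add_zero]
    have k1 := mul_le_mul_of_nonneg_left hp.1 (by linarith : 0 ≤ 1 - t)
    have k2 := mul_le_mul_of_nonneg_left hp.2.1 (by linarith : 0 ≤ 1 - t)
    have k3 := mul_le_mul_of_nonneg_left hp.2.2 (by linarith : 0 ≤ 1 - t)
    have j3 : a * ((1 - t) * p 0 - a) < -((1 - t) * p 1 + t * -1) := by nlinarith
    have k0 : (1 - t) * p 1 + t * -1 < 0 := by nlinarith
    rw [abs_of_neg k0]
    exact ⟨⟨by linarith, by linarith⟩, main' _ _ (by linarith) j3, k0⟩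
  · intro p hp t ht0 ht1
    rw [mem_triangle] at hp
    rw [mem_dart, hmem', not_le]
    simp only [PiLp.add_apply, PiLp.smul_apply, smul_eq_mul, Matrix.cons_val_zero,
      Matrix.cons_val_one, mul_zero, add_zero]
    have k1 := mul_le_mul_of_nonneg_left hp.1 (by linarith : 0 ≤ 1 - t)
    have k2 := mul_le_mul_of_nonneg_left hp.2.1 (by linarith : 0 ≤ 1 - t)
    have k3 := mul_le_mul_of_nonneg_left hp.2.2 (by linarith : 0 ≤ 1 - t)
    have j3 : a * ((1 - t) * p 0 - a) < (1 - t) * p 1 + t * 1 := by nlinarith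
    have k0 : 0 < (1 - t) * p 1 + t * 1 := by nlinarith
    rw [abs_of_pos k0]
    exact ⟨⟨by linarith, by linarith⟩, main' _ _ (by linarith) j3, k0⟩

end Cuts

/-! ### Cutting the triangle -/

section Triangle

variable {a : ℝ}

lemma subdivide_triangle (ha0 : 0 < a) (ha1 : a < 1) :
    subdivide a .vertical (triangle a) = {pieceMap a 0 '' triangle a, pieceMap a 1 '' dart a} := by
  have hr := ratio_pos ha0 ha1
  have hr' : ratio a = (1 - a ^ 2) / 2 := rfl
  have hS0 := fun p : Plane => mem_image_pieceMap_zero_triangle ha0 (p := p)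
  have hS1 := fun p : Plane => mem_image_pieceMap_one_dart ha0 ha1 (p := p)
  have hcl₁ : IsClosed (pieceMap a 0 '' triangle a) := by
    obtain ⟨f, hf, -⟩ := exists_homeo_zero ha0
    rw [← hf, f.isClosed_image]; exact isClosed_triangle
  have hcl₂ : IsClosed (pieceMap a 1 '' dart a) := by
    obtain ⟨f, hf, -⟩ := exists_homeo_one ha0 ha1
    rw [← hf, f.isClosed_image]; exact isClosed_dart
  generalize ratio a = r at *
  have hmem' : ∀ p : Plane, p ∈ rhombus a .vertical !₂[a, r] (a * r) ↔
      |p 0 - a| + a * |p 1 - r| ≤ a * r := fun p => by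
    simp [mem_rhombus_vertical]
  have haa : 0 < 1 - a ^ 2 := by nlinarith
  have hra : a * (r / a) = r := by field_simp
  have hra0 : 0 < r / a := by positivity
  -- The rhombus is `A H G D`, separated along its diagonal `AG`; the star centres are `C` and the
  -- tip `(a + r / a, r)` of the small dart, which is `B`.
  refine subdivide_eq_pair (c := !₂[a, r]) (h := a * r) (φ := fun p => p 0 - a)
    (e₁ := !₂[0, 1]) (e₂ := !₂[a + r / a, r]) (by positivity) ?_ ?_ (by fun_prop) ?_
    hcl₁ hcl₂ ?_ ?_ ?_ ?_ ?_ ?_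
  · intro p
    rw [hmem', mem_triangle]
    intro h
    have h0 := mul_nonneg haa.le (abs_nonneg (p 0 - a))
    have h0' := mul_nonneg (sq_nonneg a) (abs_nonneg (p 0 - a))
    have h1 := mul_le_mul_of_nonneg_left (le_abs_self (p 0 - a)) (sq_nonneg a)
    have h2 := neg_le_abs (p 0 - a)
    have h3 := mul_le_mul_of_nonneg_left (le_abs_self (p 1 - r)) ha0.le
    have h4 := mul_le_mul_of_nonneg_left (neg_le_abs (p 1 - r)) ha0.le
    refine ⟨?_, ?_, ?_⟩
    · refine le_of_mul_le_mul_left ?_ ha0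
      have : 2 * (a * r) = a - a ^ 3 := by rw [hr']; ring
      linarith
    · linarith
    · refine le_of_mul_le_mul_left ?_ ha0
      linarith
  · intro c h hh hs
    have h1 := (hs (top_mem_vertical ha0 c hh)).1
    have h2 := (hs (left_mem_vertical c hh)).2.1
    have h3 := (hs (bottom_mem_vertical ha0 c hh)).2.2
    simp only [Matrix.cons_val_zero, Matrix.cons_val_one] at h1 h2 h3
    obtain ⟨k, rfl⟩ : ∃ k, h = a * k := ⟨h / a, by field_simp⟩
    rw [mul_div_cancel_left₀ _ ha0.ne'] at h1 h3
    -- The top, left and bottom vertices must respect the lines `BC`, `AC`, `AB`. The weights `1 + a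
    -- ^ 2`, `2 * a`, `1 - a ^ 2` cancel the centre from the sum, leaving `k ≤ r`; at equality all
    -- constraints are tight and determine the centre.
    have w1 := mul_le_mul_of_nonneg_left h1 (by positivity : 0 ≤ 1 + a ^ 2)
    have w2 := mul_le_mul_of_nonneg_left h2 (by positivity : 0 ≤ 2 * a)
    have w3 := mul_le_mul_of_nonneg_left h3 haa.le
    have hkr : k ≤ r := by
      refine le_of_mul_le_mul_left ?_ (by positivity : 0 < 2 * (1 + a ^ 2))
      rw [hr']; linarith
    refine ⟨mul_le_mul_of_nonneg_left hkr ha0.le, fun hk => ?_⟩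
    have hk := mul_left_cancel₀ ha0.ne' hk
    rw [hk, hr'] at h1 h2 h3 w1 w2 w3
    have e1 : a * c 0 + (c 1 + (1 - a ^ 2) / 2) = 1 := by
      refine le_antisymm h1 (le_of_mul_le_mul_left ?_ (by positivity : 0 < 1 + a ^ 2))
      linarith
    have e3 : a * (c 0 - a) = c 1 - (1 - a ^ 2) / 2 := by
      refine le_antisymm h3 (le_of_mul_le_mul_left ?_ haa)
      linarith
    have e0 : c 0 = a := mul_left_cancel₀ ha0.ne' (by linarith)
    ext
    · simpa using e0
    · rw [e0] at e3
      simp [hr']; linarith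
  · intro p hp h0
    rw [mem_triangle] at hp
    rw [hmem']
    have e0 : p 0 = a := by linarith
    rw [e0] at hp ⊢
    rw [sub_self, abs_zero, zero_add]
    refine mul_le_mul_of_nonneg_left ?_ ha0.le
    rw [abs_le]
    constructor <;> nlinarith
  · intro p hp hp' h0
    rw [mem_triangle] at hp
    rw [hmem', not_le, abs_of_neg h0] at hp'
    rw [hS0]
    refine ⟨hp.1, hp.2.1, ?_⟩
    rcases le_total r (p 1) with h | h
    · rw [abs_of_nonneg (by linarith), hr'] at hp'; nlinarith
    · rw [abs_of_nonpos (by linarith)] at hp'; nlinarith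
  · intro p hp hp' h0
    rw [mem_triangle] at hp
    rw [hmem', not_le, abs_of_pos h0] at hp'
    rw [hS1]
    refine ⟨?_, hp'.le⟩
    rcases le_total r (p 1) with h | h
    · rw [abs_of_nonneg (by linarith)]; nlinarith
    · rw [abs_of_nonpos (by linarith)]; nlinarith
  · rw [hS0]; simp; linarith [pow_pos ha0 3]
  · rw [hS1]; simp [hra]
    rw [le_div_iff₀ ha0]; nlinarith
  · intro p hp t ht0 ht1
    rw [hS0] at hp
    rw [mem_triangle, hmem', not_le]
    simp only [PiLp.add_apply, PiLp.smul_apply, smul_eq_mul, Matrix.cons_val_zero,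
      Matrix.cons_val_one, mul_zero, add_zero]
    have ht : 0 ≤ 1 - t := by linarith
    have hpa : p 0 ≤ a := by
      refine le_of_mul_le_mul_left ?_ (by positivity : 0 < 1 + a ^ 2)
      nlinarith [mul_le_mul_of_nonneg_left hp.1 ha0.le]
    have k0 := mul_le_mul_of_nonneg_left hpa ht
    have k1 := mul_le_mul_of_nonneg_left hp.1 ht
    have k2 := mul_le_mul_of_nonneg_left hp.2.1 ht
    have k3 := mul_le_mul_of_nonneg_left hp.2.2 ht
    have hta : 0 < t * a := by positivity
    have hta3 : 0 < t * a ^ 3 := by positivity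
    have j0 : (1 - t) * p 0 - a < 0 := by nlinarith
    have j1 : (1 - t) * p 0 - a * ((1 - t) * p 1 + t * 1) < a ^ 3 := by nlinarith
    refine ⟨⟨by linarith, by linarith, ?_⟩, ?_, j0⟩
    · have h5 : a * ((1 - t) * p 0 - a) < 0 := mul_neg_of_pos_of_neg ha0 j0
      have h6 : 0 ≤ p 1 := by nlinarith
      have h7 : 0 ≤ (1 - t) * p 1 := mul_nonneg ht h6
      linarith
    · rw [abs_of_neg j0]
      have := mul_le_mul_of_nonneg_left (le_abs_self ((1 - t) * p 1 + t * 1 - r)) ha0.le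
      have e : 2 * (a * r) = a - a ^ 3 := by rw [hr']; ring
      linarith
  · intro p hp t ht0 ht1
    have hpa : 0 ≤ p 0 - a := by
      obtain ⟨q, hq, rfl⟩ := hp
      have := nonneg_of_mem_dart ha0 ha1 hq
      have hr0 := ratio_pos ha0 ha1
      simp only [pieceMap_one_zero, add_sub_cancel_left]
      positivity
    rw [hS1] at hp
    rw [mem_triangle, hmem', not_le]
    simp only [PiLp.add_apply, PiLp.smul_apply, smul_eq_mul, Matrix.cons_val_zero,
      Matrix.cons_val_one]
    have ht : 0 ≤ 1 - t := by linarith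
    have e0 : (1 - t) * p 0 + t * (a + r / a) - a = (1 - t) * (p 0 - a) + t * (r / a) := by ring
    have e1 : |(1 - t) * p 1 + t * r - r| = (1 - t) * |p 1 - r| := by
      rw [show (1 - t) * p 1 + t * r - r = (1 - t) * (p 1 - r) by ring, abs_mul, abs_of_nonneg ht]
    have k1 := mul_le_mul_of_nonneg_left hp.1 ht
    have k2 := mul_le_mul_of_nonneg_left hp.2 ht
    have j0 : 0 < (1 - t) * p 0 + t * (a + r / a) - a := by
      rw [e0]; exact add_pos_of_nonneg_of_pos (mul_nonneg ht hpa) (by positivity)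
    have j1 : a * ((1 - t) * p 0 + t * (a + r / a) - a) + |(1 - t) * p 1 + t * r - r| ≤ r := by
      rw [e0, e1, mul_add, mul_left_comm a t, hra]; linarith
    have j2 : a * r < (1 - t) * p 0 + t * (a + r / a) - a +
        a * |(1 - t) * p 1 + t * r - r| := by
      rw [e0, e1]
      have : a * r < r / a := by
        rw [lt_div_iff₀ ha0]; nlinarith
      have := mul_lt_mul_of_pos_left this ht0
      linarith
    generalize (1 - t) * p 0 + t * (a + r / a) = x at *
    generalize (1 - t) * p 1 + t * r = y at *
    have j3 := le_abs_self (y - r)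
    have j4 := neg_le_abs (y - r)
    have j5 : 0 < a * (x - a) := mul_pos ha0 j0
    refine ⟨⟨by rw [hr'] at *; linarith, ?_, by linarith⟩, ?_, j0⟩
    · nlinarith
    · rwa [abs_of_pos j0]

end Triangle

/-! ### Recursion for the iterates and the limit set -/

section Recursion

variable {a : ℝ}

/-- The part of the `(n + 2)`-nd iterate in the upper-right triangle. -/
def triangleIterate (a : ℝ) (n : ℕ) : Set Plane := descent a .vertical n (triangle a)

/-- The part of the `(n + 1)`-st iterate in the right-hand dart. -/
def dartIterate (a : ℝ) (n : ℕ) : Set Plane := descent a .horizontal n (dart a)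

lemma iterate_succ (ha0 : 0 < a) (ha1 : a < 1) (n : ℕ) :
    iterate a (n + 1) = reflX '' dartIterate a n ∪ dartIterate a n := by
  rw [iterate_eq_descent, descent_succ, subdivide_rhombus ha0 ha1, biUnion_pair]
  exact congrArg (· ∪ _) ((isRhombic_reflX a).descent_image .horizontal n (dart a))

lemma dartIterate_succ (ha0 : 0 < a) (ha1 : a < 1) (n : ℕ) :
    dartIterate a (n + 1) = reflY '' triangleIterate a n ∪ triangleIterate a n := by
  rw [dartIterate, descent_succ, subdivide_dart ha0 ha1, biUnion_pair]
  exact congrArg (· ∪ _) ((isRhombic_reflY a).descent_image .vertical n (triangle a))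

lemma triangleIterate_succ (ha0 : 0 < a) (ha1 : a < 1) (n : ℕ) :
    triangleIterate a (n + 1) =
      pieceMap a 0 '' triangleIterate a n ∪ pieceMap a 1 '' dartIterate a n := by
  rw [triangleIterate, descent_succ, subdivide_triangle ha0 ha1, biUnion_pair]
  obtain ⟨f, hf, hf'⟩ := exists_homeo_zero ha0
  obtain ⟨g, hg, hg'⟩ := exists_homeo_one ha0 ha1
  rw [← hf, ← hg]
  exact congrArg₂ (· ∪ ·) (hf'.descent_image .vertical n (triangle a))
    (hg'.descent_image .horizontal n (dart a))

/-- Pieces 1 and 2 lag one stage behind piece 0, since the dart must be split first. The lag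
disappears in the limit. -/
lemma triangleIterate_add_two (ha0 : 0 < a) (ha1 : a < 1) (n : ℕ) :
    triangleIterate a (n + 2) = pieceMap a 0 '' triangleIterate a (n + 1) ∪
      (pieceMap a 2 '' triangleIterate a n ∪ pieceMap a 1 '' triangleIterate a n) := by
  rw [triangleIterate_succ ha0 ha1, dartIterate_succ ha0 ha1, image_union, ← image_comp]
  have : pieceMap a 1 ∘ reflY = pieceMap a 2 := funext fun p => (pieceMap_two_eq p).symm
  rw [this]

lemma triangle_subset_dart (ha0 : 0 < a) : triangle a ⊆ dart a := fun p hp => by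
  have h := nonneg_of_mem_triangle ha0 hp
  rw [mem_dart, abs_of_nonneg h]
  exact ⟨hp.1, hp.2.1⟩

lemma reflY_triangle_subset_dart (ha0 : 0 < a) : reflY '' triangle a ⊆ dart a := by
  rintro _ ⟨p, hp, rfl⟩
  have := triangle_subset_dart ha0 hp
  simpa [mem_dart] using this

lemma pieceMap_zero_triangle_subset (ha0 : 0 < a) :
    pieceMap a 0 '' triangle a ⊆ triangle a := fun p hp => by
  obtain ⟨h1, h2, h3⟩ := (mem_image_pieceMap_zero_triangle ha0).1 hp
  refine ⟨h1, h2, ?_⟩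
  have hpa : p 0 ≤ a := by
    refine le_of_mul_le_mul_left ?_ (by positivity : 0 < 1 + a ^ 2)
    nlinarith [mul_le_mul_of_nonneg_left h1 ha0.le]
  nlinarith

lemma pieceMap_one_dart_subset (ha0 : 0 < a) (ha1 : a < 1) :
    pieceMap a 1 '' dart a ⊆ triangle a := fun p hp => by
  have hpa : 0 ≤ p 0 - a := by
    obtain ⟨q, hq, rfl⟩ := hp
    have := nonneg_of_mem_dart ha0 ha1 hq
    have hr0 := ratio_pos ha0 ha1
    simp only [pieceMap_one_zero, add_sub_cancel_left]
    positivity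
  obtain ⟨h1, h2⟩ := (mem_image_pieceMap_one_dart ha0 ha1).1 hp
  have hr' : ratio a = (1 - a ^ 2) / 2 := rfl
  have j3 := le_abs_self (p 1 - ratio a)
  have j4 := neg_le_abs (p 1 - ratio a)
  have j5 : 0 ≤ a * (p 0 - a) := mul_nonneg ha0.le hpa
  refine ⟨?_, ?_, ?_⟩ <;> nlinarith

lemma iterates_succ_subset (ha0 : 0 < a) (ha1 : a < 1) (n : ℕ) :
    triangleIterate a (n + 1) ⊆ triangleIterate a n ∧ dartIterate a (n + 1) ⊆ dartIterate a n := by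
  induction n with
  | zero =>
    rw [triangleIterate_succ ha0 ha1, dartIterate_succ ha0 ha1]
    exact ⟨union_subset (pieceMap_zero_triangle_subset ha0) (pieceMap_one_dart_subset ha0 ha1),
      union_subset (reflY_triangle_subset_dart ha0) (triangle_subset_dart ha0)⟩
  | succ n ih =>
    obtain ⟨h1, h2⟩ := ih
    rw [triangleIterate_succ ha0 ha1 (n + 1), dartIterate_succ ha0 ha1 (n + 1)]
    constructor
    · refine (union_subset_union (image_mono h1) (image_mono h2)).trans ?_
      rw [← triangleIterate_succ ha0 ha1]
    · refine (union_subset_union (image_mono h1) h1).trans ?_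
      rw [← dartIterate_succ ha0 ha1]

lemma antitone_triangleIterate (ha0 : 0 < a) (ha1 : a < 1) : Antitone (triangleIterate a) :=
  antitone_nat_of_succ_le fun n => (iterates_succ_subset ha0 ha1 n).1

lemma isClosed_iterates (ha0 : 0 < a) (ha1 : a < 1) (n : ℕ) :
    IsClosed (triangleIterate a n) ∧ IsClosed (dartIterate a n) := by
  induction n with
  | zero => exact ⟨isClosed_triangle, isClosed_dart⟩
  | succ n ih =>
    obtain ⟨f, hf⟩ := exists_homeo ha0 ha1 0
    obtain ⟨g, hg⟩ := exists_homeo ha0 ha1 1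
    rw [triangleIterate_succ ha0 ha1, dartIterate_succ ha0 ha1, ← hf, ← hg]
    exact ⟨((f.isClosed_image).2 ih.1).union ((g.isClosed_image).2 ih.2),
      ((reflY.isClosed_image).2 ih.1).union ih.1⟩

/-- The limit set in the upper-right triangle. -/
def limitSet (a : ℝ) : Set Plane := ⋂ n, triangleIterate a n

lemma limitSet_subset_triangle : limitSet a ⊆ triangle a := iInter_subset _ 0

lemma isClosed_limitSet (ha0 : 0 < a) (ha1 : a < 1) : IsClosed (limitSet a) :=
  isClosed_iInter fun n => (isClosed_iterates ha0 ha1 n).1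

lemma limitSet_eq_iUnion (ha0 : 0 < a) (ha1 : a < 1) :
    limitSet a = ⋃ i, pieceMap a i '' limitSet a := by
  have hanti := antitone_triangleIterate ha0 ha1
  have hinter : ∀ i, pieceMap a i '' limitSet a = ⋂ n, pieceMap a i '' triangleIterate a n :=
    fun i => by
      obtain ⟨f, hf⟩ := exists_homeo ha0 ha1 i
      rw [← hf]
      exact image_iInter f.bijective _
  apply Subset.antisymm
  · intro x hx
    -- A point outside all three images is missing from the image of some iterate for each map;
    -- monotonicity then excludes it from one later common stage.
    by_contra hcon
    simp only [mem_iUnion, not_exists, hinter, mem_iInter, not_forall] at hcon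
    choose n hn using hcon
    have hle : ∀ i, n i ≤ n 0 + n 1 + n 2 := fun i => by fin_cases i <;> simp <;> omega
    have hx' := mem_iInter.1 hx (n 0 + n 1 + n 2 + 2)
    rw [triangleIterate_add_two ha0 ha1] at hx'
    rcases hx' with h | h | h
    · exact hn 0 (image_mono (hanti ((hle 0).trans (Nat.le_succ _))) h)
    · exact hn 2 (image_mono (hanti (hle 2)) h)
    · exact hn 1 (image_mono (hanti (hle 1)) h)
  · refine iUnion_subset fun i => ?_
    rintro _ ⟨x, hx, rfl⟩
    refine mem_iInter.2 fun n => hanti (show n ≤ n + 2 by omega) ?_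
    have hx' := mem_iInter.1 hx
    rw [triangleIterate_add_two ha0 ha1]
    fin_cases i
    · exact Or.inl ⟨x, hx' _, rfl⟩
    · exact Or.inr (Or.inr ⟨x, hx' _, rfl⟩)
    · exact Or.inr (Or.inl ⟨x, hx' _, rfl⟩)

lemma pieceMap_zero_ptC : pieceMap a 0 ptC = ptC := by
  ext <;> simp [ptC]

lemma ptC_mem_limitSet (ha0 : 0 < a) (ha1 : a < 1) : ptC ∈ limitSet a := by
  refine mem_iInter.2 fun n => ?_
  induction n with
  | zero =>
    change ptC ∈ triangle a
    rw [mem_triangle]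
    simp [ptC]; nlinarith
  | succ n ih =>
    rw [triangleIterate_succ ha0 ha1]
    exact Or.inl ⟨ptC, ih, pieceMap_zero_ptC⟩

/-- After two cuts there are four mirror-image triangles, one per quadrant; absolute values fold
them together. -/
lemma mem_iterate_add_two (ha0 : 0 < a) (ha1 : a < 1) (n : ℕ) (p : Plane) :
    p ∈ iterate a (n + 2) ↔ !₂[|p 0|, |p 1|] ∈ triangleIterate a n := by
  have hnn : ∀ q ∈ triangleIterate a n, 0 ≤ q 0 ∧ 0 ≤ q 1 := fun q hq => by
    have := antitone_triangleIterate ha0 ha1 n.zero_le hq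
    exact ⟨fst_nonneg_of_mem_triangle ha0 ha1 this, nonneg_of_mem_triangle ha0 this⟩
  have habs : ∀ q ∈ triangleIterate a n, !₂[|q 0|, |q 1|] = q := fun q hq => by
    obtain ⟨h0, h1⟩ := hnn q hq
    ext
    · simpa using h0
    · simpa using h1
  rw [iterate_succ ha0 ha1, dartIterate_succ ha0 ha1]
  constructor
  · rintro (⟨_, ⟨q, hq, rfl⟩ | hq, rfl⟩ | ⟨q, hq, rfl⟩ | hq)
    · simpa [habs q hq] using hq
    · rename_i q
      simpa [habs q hq] using hq
    · simpa [habs q hq] using hq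
    · simpa [habs p hq] using hq
  · intro h
    rcases le_total 0 (p 0) with h0 | h0 <;> rcases le_total 0 (p 1) with h1 | h1
    · rw [abs_of_nonneg h0, abs_of_nonneg h1] at h
      have e : !₂[p 0, p 1] = p := by ext <;> simp
      rw [e] at h
      exact Or.inr (Or.inr h)
    · rw [abs_of_nonneg h0, abs_of_nonpos h1] at h
      exact Or.inr (Or.inl ⟨_, h, by ext <;> simp⟩)
    · rw [abs_of_nonpos h0, abs_of_nonneg h1] at h
      exact Or.inl ⟨_, Or.inr h, by ext <;> simp⟩
    · rw [abs_of_nonpos h0, abs_of_nonpos h1] at h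
      exact Or.inl ⟨_, Or.inl ⟨_, h, rfl⟩, by ext <;> simp⟩

lemma mem_fractal_iff (ha0 : 0 < a) (ha1 : a < 1) (p : Plane) :
    p ∈ fractal a ↔ !₂[|p 0|, |p 1|] ∈ limitSet a := by
  rw [fractal, limitSet, mem_iInter₂, mem_iInter]
  constructor
  · intro h n
    exact (mem_iterate_add_two ha0 ha1 n p).1 (h (n + 2) (by omega))
  · intro h k hk
    rcases hk.eq_or_lt with rfl | hk
    -- Stage 1 precedes the folded description; it contains stage 2.
    · have h2 := (mem_iterate_add_two ha0 ha1 0 p).2 (h 0)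
      have hs := (iterates_succ_subset ha0 ha1 0).2
      rw [iterate_succ ha0 ha1] at h2
      rw [← zero_add 1, iterate_succ ha0 ha1]
      exact union_subset_union (image_mono hs) hs h2
    · obtain ⟨n, rfl⟩ := Nat.exists_eq_add_of_le' hk
      exact (mem_iterate_add_two ha0 ha1 n p).2 (h n)

lemma quarter_eq_limitSet (ha0 : 0 < a) (ha1 : a < 1) : quarter a = limitSet a := by
  ext p
  have e : !₂[p 0, p 1] = p := by ext <;> simp
  constructor
  · rintro ⟨hp, h0, h1⟩
    rwa [mem_fractal_iff ha0 ha1, abs_of_nonneg h0, abs_of_nonneg h1, e] at hp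
  · intro hp
    have h0 := fst_nonneg_of_mem_triangle ha0 ha1 (limitSet_subset_triangle hp)
    have h1 := nonneg_of_mem_triangle ha0 (limitSet_subset_triangle hp)
    refine ⟨?_, h0, h1⟩
    rwa [mem_fractal_iff ha0 ha1, abs_of_nonneg h0, abs_of_nonneg h1, e]

lemma isometry_reflX : Isometry reflX := Isometry.of_dist_eq fun p q => by
  simp [EuclideanSpace.dist_eq, Real.dist_eq]
  congr 2; ring

lemma isometry_reflY : Isometry reflY := Isometry.of_dist_eq fun p q => by
  simp [EuclideanSpace.dist_eq, Real.dist_eq]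
  congr 1; ring

lemma dimH_fractal (ha0 : 0 < a) (ha1 : a < 1) : dimH (fractal a) = dimH (quarter a) := by
  refine le_antisymm ?_ (dimH_mono inter_subset_left)
  have hsub : fractal a ⊆ (limitSet a ∪ reflY '' limitSet a) ∪
      reflX '' (limitSet a ∪ reflY '' limitSet a) := fun p hp => by
    rw [mem_fractal_iff ha0 ha1] at hp
    rcases le_total 0 (p 0) with h0 | h0 <;> rcases le_total 0 (p 1) with h1 | h1
    · rw [abs_of_nonneg h0, abs_of_nonneg h1] at hp
      have e : !₂[p 0, p 1] = p := by ext <;> simp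
      rw [e] at hp
      exact Or.inl (Or.inl hp)
    · rw [abs_of_nonneg h0, abs_of_nonpos h1] at hp
      exact Or.inl (Or.inr ⟨_, hp, by ext <;> simp⟩)
    · rw [abs_of_nonpos h0, abs_of_nonneg h1] at hp
      exact Or.inr ⟨_, Or.inl hp, by ext <;> simp⟩
    · rw [abs_of_nonpos h0, abs_of_nonpos h1] at hp
      exact Or.inr ⟨_, Or.inr ⟨_, hp, rfl⟩, by ext <;> simp⟩
  refine (dimH_mono hsub).trans ?_
  rw [dimH_union, isometry_reflX.dimH_image, dimH_union, isometry_reflY.dimH_image, max_self,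
    max_self, quarter_eq_limitSet ha0 ha1]

end Recursion

/-! ### Metric estimates, open set condition and Moran's equation -/

section Metric

variable {a : ℝ}

lemma Plane.dist_eq (p q : Plane) : dist p q = √((p 0 - q 0) ^ 2 + (p 1 - q 1) ^ 2) := by
  simp [EuclideanSpace.dist_eq, Real.dist_eq]

lemma Plane.abs_sub_zero_le_dist (p q : Plane) : |p 0 - q 0| ≤ dist p q := by
  rw [Plane.dist_eq]
  exact Real.abs_le_sqrt (by nlinarith [sq_nonneg (p 1 - q 1)])

lemma Plane.abs_sub_one_le_dist (p q : Plane) : |p 1 - q 1| ≤ dist p q := by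
  rw [Plane.dist_eq]
  exact Real.abs_le_sqrt (by nlinarith [sq_nonneg (p 0 - q 0)])

lemma Plane.dist_le (p q : Plane) : dist p q ≤ |p 0 - q 0| + |p 1 - q 1| := by
  rw [Plane.dist_eq]
  refine Real.sqrt_le_iff.2 ⟨by positivity, ?_⟩
  have h0 := sq_abs (p 0 - q 0)
  have h1 := sq_abs (p 1 - q 1)
  nlinarith [mul_nonneg (abs_nonneg (p 0 - q 0)) (abs_nonneg (p 1 - q 1))]

/-- The contraction ratios. -/
noncomputable def pieceRatio (a : ℝ) : Fin 3 → ℝ := ![a, ratio a, ratio a]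

lemma pieceRatio_pos (ha0 : 0 < a) (ha1 : a < 1) (i : Fin 3) : 0 < pieceRatio a i := by
  have := ratio_pos ha0 ha1
  fin_cases i <;> simpa [pieceRatio]

lemma pieceRatio_lt_one (ha0 : 0 < a) (ha1 : a < 1) (i : Fin 3) : pieceRatio a i < 1 := by
  have : ratio a < 1 := by unfold ratio; nlinarith
  fin_cases i <;> simpa [pieceRatio]

lemma dist_pieceMap (ha0 : 0 < a) (ha1 : a < 1) (i : Fin 3) (x y : Plane) :
    dist (pieceMap a i x) (pieceMap a i y) = pieceRatio a i * dist x y := by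
  have hr := (pieceRatio_pos ha0 ha1 i).le
  have key : (pieceMap a i x 0 - pieceMap a i y 0) ^ 2 + (pieceMap a i x 1 - pieceMap a i y 1) ^ 2 =
      pieceRatio a i ^ 2 * ((x 0 - y 0) ^ 2 + (x 1 - y 1) ^ 2) := by
    fin_cases i <;> simp [pieceRatio] <;> ring
  rw [Plane.dist_eq, Plane.dist_eq, key, Real.sqrt_mul (sq_nonneg _), Real.sqrt_sq hr]

lemma isContractingSimilarity_pieceMap (ha0 : 0 < a) (ha1 : a < 1) (i : Fin 3) :
    IsContractingSimilarity (pieceMap a i) (pieceRatio a i) :=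
  ⟨pieceRatio_pos ha0 ha1 i, pieceRatio_lt_one ha0 ha1 i, dist_pieceMap ha0 ha1 i⟩

lemma pieceMap_zero_points (ha0 : 0 < a) :
    pieceMap a 0 (ptA a) = ptG a ∧ pieceMap a 0 (ptB a) = ptD a ∧ pieceMap a 0 ptC = ptC := by
  refine ⟨?_, ?_, pieceMap_zero_ptC⟩
  · ext <;> simp [ptA, ptG]; ring
  · ext <;> simp [ptB, ptD] <;> field_simp <;> ring

lemma pieceMap_one_points (ha0 : 0 < a) :
    pieceMap a 1 (ptA a) = ptH a ∧ pieceMap a 1 (ptB a) = ptF a ∧ pieceMap a 1 ptC = ptG a := by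
  refine ⟨?_, ?_, ?_⟩
  · ext <;> simp [ptA, ptH, ratio]; ring
  · ext <;> simp [ptB, ptF, ratio] <;> field_simp <;> ring
  · ext <;> simp [ptC, ptG, ratio]

lemma pieceMap_two_points (ha0 : 0 < a) :
    pieceMap a 2 (ptA a) = ptH a ∧ pieceMap a 2 (ptB a) = ptE a ∧ pieceMap a 2 ptC = ptA a := by
  refine ⟨?_, ?_, ?_⟩
  · ext <;> simp [ptA, ptH, ratio]; ring
  · ext <;> simp [ptB, ptE, ratio] <;> field_simp <;> ring
  · ext <;> simp [ptC, ptA]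

lemma pieceMap_triangle_subset (ha0 : 0 < a) (ha1 : a < 1) (i : Fin 3) :
    pieceMap a i '' triangle a ⊆ triangle a := by
  fin_cases i
  · exact pieceMap_zero_triangle_subset ha0
  · exact (image_mono (triangle_subset_dart ha0)).trans (pieceMap_one_dart_subset ha0 ha1)
  · rintro _ ⟨p, hp, rfl⟩
    refine pieceMap_one_dart_subset ha0 ha1 ⟨reflY p, ?_, (pieceMap_two_eq p).symm⟩
    exact reflY_triangle_subset_dart ha0 ⟨p, hp, rfl⟩

/-- The triangle is the convex hull of its vertices. -/
lemma convexHull_eq_triangle (ha0 : 0 < a) (ha1 : a < 1) :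
    convexHull ℝ {ptA a, ptB a, ptC} = triangle a := by
  have haa : 0 < 1 - a ^ 2 := by nlinarith
  have haa' : 0 < 1 - a ^ 4 := by nlinarith [sq_nonneg a]
  apply Subset.antisymm
  · refine convexHull_min ?_ ?_
    · have h2 : a * ((1 + a ^ 2) / (2 * a)) = (1 + a ^ 2) / 2 := by field_simp
      rintro p (rfl | rfl | rfl)
      · simp [mem_triangle, ptA]; nlinarith
      · simp only [mem_triangle, ptB, Matrix.cons_val_zero, Matrix.cons_val_one]
        refine ⟨by linarith, ?_, by linarith⟩
        refine le_of_mul_le_mul_left ?_ ha0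
        rw [mul_add, h2]; nlinarith [mul_pos haa haa]
      · simp [mem_triangle, ptC]; nlinarith
    · intro p hp q hq u v hu hv huv
      simp only [mem_triangle, PiLp.add_apply, PiLp.smul_apply, smul_eq_mul] at *
      obtain ⟨p1, p2, p3⟩ := hp
      obtain ⟨q1, q2, q3⟩ := hq
      obtain rfl : v = 1 - u := by linarith
      refine ⟨?_, ?_, ?_⟩
      · nlinarith [mul_le_mul_of_nonneg_left p1 hu, mul_le_mul_of_nonneg_left q1 hv]
      · nlinarith [mul_le_mul_of_nonneg_left p2 hu, mul_le_mul_of_nonneg_left q2 hv]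
      · nlinarith [mul_le_mul_of_nonneg_left p3 hu, mul_le_mul_of_nonneg_left q3 hv]
  · intro p hp
    obtain ⟨h1, h2, h3⟩ := hp
    -- Barycentric coordinates: each weight is the defining form of the opposite side, normalised to
    -- `1` at the vertex.
    have key : p = ∑ i : Fin 3, (![(1 - a * p 0 - p 1) / (1 - a ^ 2),
        2 * a * (p 0 + a * p 1 - a) / (1 - a ^ 4), (p 1 - a * (p 0 - a)) / (1 + a ^ 2)] i) •
        ((![ptA a, ptB a, ptC] : Fin 3 → Plane) i) := by
      rw [show 1 - a ^ 4 = (1 - a ^ 2) * (1 + a ^ 2) by ring]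
      ext <;> simp [Fin.sum_univ_three, ptA, ptB, ptC] <;> field_simp <;> ring
    rw [key]
    refine (convex_convexHull ℝ _).sum_mem ?_ ?_ ?_
    · intro i _
      fin_cases i
      · exact div_nonneg (by linarith) haa.le
      · exact div_nonneg (mul_nonneg (by positivity) (by linarith)) haa'.le
      · exact div_nonneg (by linarith) (by positivity)
    · rw [show 1 - a ^ 4 = (1 - a ^ 2) * (1 + a ^ 2) by ring]
      simp [Fin.sum_univ_three]; field_simp; ring
    · intro i _
      apply subset_convexHull
      fin_cases i <;> simp

lemma isCompact_triangle (ha0 : 0 < a) (ha1 : a < 1) : IsCompact (triangle a) := by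
  rw [← convexHull_eq_triangle ha0 ha1]
  exact (toFinite _).isCompact_convexHull ℝ

lemma isCompact_limitSet (ha0 : 0 < a) (ha1 : a < 1) : IsCompact (limitSet a) :=
  (isCompact_triangle ha0 ha1).of_isClosed_subset (isClosed_limitSet ha0 ha1)
    limitSet_subset_triangle

lemma abs_sub_one_le_of_mem_triangle (ha0 : 0 < a) (ha1 : a < 1) {p : Plane}
    (hp : p ∈ triangle a) : a * |p 1 - 1| ≤ p 0 := by
  have h0 := fst_nonneg_of_mem_triangle ha0 ha1 hp
  obtain ⟨h1, h2, h3⟩ := hp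
  have e : a * |p 1 - 1| = |a * (p 1 - 1)| := by rw [abs_mul, abs_of_pos ha0]
  rw [e, abs_le]
  constructor
  · linarith
  · nlinarith [mul_nonneg (sq_nonneg a) h0]

/-- The vertical line through `G` separates the pieces. Each lies in a cone at `G`, so its distance
to `G` is at most `1 + 1 / a` times its horizontal offset, and the two offsets add. -/
lemma dist_zero_one (ha0 : 0 < a) (ha1 : a < 1) {x y : Plane} (hx : x ∈ triangle a)
    (hy : y ∈ triangle a) :
    dist (pieceMap a 0 x) (ptG a) ≤
      (1 + 1 / a) * dist (pieceMap a 0 x) (pieceMap a 1 y) ∧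
    dist (pieceMap a 1 y) (ptG a) ≤
      (1 + 1 / a) * dist (pieceMap a 0 x) (pieceMap a 1 y) := by
  have hr := ratio_pos ha0 ha1
  have hr' : ratio a = (1 - a ^ 2) / 2 := rfl
  have x1 := nonneg_of_mem_triangle ha0 hx
  have y0 := fst_nonneg_of_mem_triangle ha0 ha1 hy
  have hd := Plane.abs_sub_zero_le_dist (pieceMap a 0 x) (pieceMap a 1 y)
  have hd' := (neg_le_abs _).trans hd
  simp only [pieceMap_zero_zero, pieceMap_one_zero] at hd'
  have e1 := Plane.dist_le (pieceMap a 0 x) (ptG a)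
  have e2 := Plane.dist_le (pieceMap a 1 y) (ptG a)
  have hax := abs_sub_le_of_mem_triangle ha0 ha1 hx
  have hay := abs_sub_one_le_of_mem_triangle ha0 ha1 hy
  have k0 : pieceMap a 0 x 0 - ptG a 0 = -(a * x 1) := by simp [ptG]; ring
  have k1 : pieceMap a 0 x 1 - ptG a 1 = -(a * (x 0 - a)) := by simp [ptG]; ring
  have l0 : pieceMap a 1 y 0 - ptG a 0 = ratio a * y 0 := by simp [ptG]
  have l1 : pieceMap a 1 y 1 - ptG a 1 = ratio a * (y 1 - 1) := by simp [ptG]; rw [hr']; ring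
  rw [k0, k1, abs_neg, abs_neg, abs_mul, abs_mul, abs_of_pos ha0, abs_of_nonneg x1] at e1
  rw [l0, l1, abs_mul, abs_mul, abs_of_pos hr, abs_of_nonneg y0] at e2
  have ry := mul_nonneg hr.le y0
  have ax := mul_nonneg ha0.le x1
  have f1 : a * |x 0 - a| ≤ 1 / a * (a * x 1) := by
    rw [← mul_assoc, one_div_mul_cancel ha0.ne', one_mul]; exact hax
  have f2 : ratio a * |y 1 - 1| ≤ 1 / a * (ratio a * y 0) := by
    rw [mul_left_comm]
    refine mul_le_mul_of_nonneg_left ?_ hr.le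
    rw [one_div, ← div_eq_inv_mul, le_div_iff₀ ha0]; linarith
  have h1a : 0 ≤ 1 + 1 / a := by positivity
  constructor
  · refine e1.trans ?_
    calc a * x 1 + a * |x 0 - a| ≤ (1 + 1 / a) * (a * x 1) := by linarith
      _ ≤ _ := mul_le_mul_of_nonneg_left (by linarith) h1a
  · refine e2.trans ?_
    calc ratio a * y 0 + ratio a * |y 1 - 1| ≤ (1 + 1 / a) * (ratio a * y 0) := by linarith
      _ ≤ _ := mul_le_mul_of_nonneg_left (by linarith) h1a

/-- The same argument with the horizontal line through `H`, the axis of symmetry between pieces 1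
and 2. -/
lemma dist_one_two (ha0 : 0 < a) (ha1 : a < 1) {x y : Plane} (hx : x ∈ triangle a)
    (hy : y ∈ triangle a) :
    dist (pieceMap a 1 x) (ptH a) ≤
      (1 + 1 / a) * dist (pieceMap a 1 x) (pieceMap a 2 y) ∧
    dist (pieceMap a 2 y) (ptH a) ≤
      (1 + 1 / a) * dist (pieceMap a 1 x) (pieceMap a 2 y) := by
  have hr := ratio_pos ha0 ha1
  have x1 := nonneg_of_mem_triangle ha0 hx
  have y1 := nonneg_of_mem_triangle ha0 hy
  have hd := (le_abs_self _).trans (Plane.abs_sub_one_le_dist (pieceMap a 1 x) (pieceMap a 2 y))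
  simp only [pieceMap_one_one, pieceMap_two_one] at hd
  have hA := (dist_pieceMap ha0 ha1 1 x (ptA a))
  have hA' := (dist_pieceMap ha0 ha1 2 y (ptA a))
  rw [(pieceMap_one_points ha0).1] at hA
  rw [(pieceMap_two_points ha0).1] at hA'
  have near : ∀ z ∈ triangle a, dist z (ptA a) ≤ (1 + 1 / a) * z 1 := fun z hz => by
    have h := abs_sub_le_of_mem_triangle ha0 ha1 hz
    have h0 := nonneg_of_mem_triangle ha0 hz
    have h1 : |z 0 - a| ≤ 1 / a * z 1 := by
      rw [one_div, ← div_eq_inv_mul, le_div_iff₀ ha0]; linarith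
    have h2 := Plane.dist_le z (ptA a)
    simp only [ptA, Matrix.cons_val_zero, Matrix.cons_val_one, sub_zero, abs_of_nonneg h0] at h2 ⊢
    linarith
  have h1a : 0 ≤ 1 + 1 / a := by positivity
  have nx := mul_le_mul_of_nonneg_left (near x hx) hr.le
  have ny := mul_le_mul_of_nonneg_left (near y hy) hr.le
  have rx := mul_nonneg hr.le x1
  have ry := mul_nonneg hr.le y1
  rw [hA, hA']
  change ratio a * _ ≤ _ ∧ ratio a * _ ≤ _
  constructor
  · refine nx.trans ?_
    rw [mul_left_comm]
    exact mul_le_mul_of_nonneg_left (by linarith) h1a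
  · refine ny.trans ?_
    rw [mul_left_comm]
    exact mul_le_mul_of_nonneg_left (by linarith) h1a

/-- The horizontal and vertical offsets sum to at least `2 * (a * ratio a)`, and each is at most the
distance. -/
lemma dist_zero_two (ha0 : 0 < a) (ha1 : a < 1) {x y : Plane} (hx : x ∈ triangle a)
    (hy : y ∈ triangle a) : a * ratio a ≤ dist (pieceMap a 0 x) (pieceMap a 2 y) := by
  have hr := ratio_pos ha0 ha1
  have hr' : ratio a = (1 - a ^ 2) / 2 := rfl
  have y1 := nonneg_of_mem_triangle ha0 hy
  have d0 := (neg_le_abs _).trans (Plane.abs_sub_zero_le_dist (pieceMap a 0 x) (pieceMap a 2 y))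
  have d1 := (le_abs_self _).trans (Plane.abs_sub_one_le_dist (pieceMap a 0 x) (pieceMap a 2 y))
  simp only [pieceMap_zero_zero, pieceMap_two_zero, pieceMap_zero_one, pieceMap_two_one] at d0 d1
  obtain ⟨hx1, hx2, hx3⟩ := hx
  have k1 : a * x 0 ≤ (1 + a ^ 2) / 2 := by linarith
  have k2 := mul_le_mul_of_nonneg_left k1 (by linarith : 0 ≤ 1 - a)
  have k3 := mul_le_mul_of_nonneg_left hx3 ha0.le
  have k4 : a ≤ y 0 + y 1 := by nlinarith [hy.2.1]
  have k5 := mul_le_mul_of_nonneg_left k4 hr.le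
  nlinarith

lemma isChain_limitSet (ha0 : 0 < a) (ha1 : a < 1) :
    IsChain (pieceMap a) (pieceRatio a) (limitSet a) (ptA a) ptC where
  pos := pieceRatio_pos ha0 ha1
  lt_one := pieceRatio_lt_one ha0 ha1
  eq_iUnion := limitSet_eq_iUnion ha0 ha1
  memA := by
    rw [limitSet_eq_iUnion ha0 ha1]
    exact mem_iUnion.2 ⟨2, ptC, ptC_mem_limitSet ha0 ha1, (pieceMap_two_points ha0).2.2⟩
  memC := ptC_mem_limitSet ha0 ha1
  map_zero_C := pieceMap_zero_ptC
  map_one_C := (pieceMap_one_points ha0).2.2.trans (pieceMap_zero_points ha0).1.symm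
  map_two_A := (pieceMap_two_points ha0).1.trans (pieceMap_one_points ha0).1.symm
  map_two_C := (pieceMap_two_points ha0).2.2

lemma isChainGauge_dist (ha0 : 0 < a) (ha1 : a < 1) :
    IsChainGauge (pieceMap a) (pieceRatio a) (limitSet a) (ptA a) ptC dist where
  symm := dist_comm
  nonneg _ _ := dist_nonneg
  bounded := by
    obtain ⟨D, hD⟩ := Metric.isBounded_iff.1 (isCompact_limitSet ha0 ha1).isBounded
    exact ⟨D, fun x hx y hy => hD hx hy⟩
  map i x _ y _ := dist_pieceMap ha0 ha1 i x y
  quasi := ⟨1, zero_le_one, fun x _ y _ z _ => by rw [one_mul]; exact dist_triangle x y z⟩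
  zero_one := ⟨1 + 1 / a, by positivity, fun x hx y hy => by
    rw [(pieceMap_zero_points ha0).1]
    exact dist_zero_one ha0 ha1 (limitSet_subset_triangle hx) (limitSet_subset_triangle hy)⟩
  one_two := ⟨1 + 1 / a, by positivity, fun x hx y hy => by
    rw [(pieceMap_one_points ha0).1]
    exact dist_one_two ha0 ha1 (limitSet_subset_triangle hx) (limitSet_subset_triangle hy)⟩
  zero_two := ⟨a * ratio a, mul_pos ha0 (ratio_pos ha0 ha1), fun x hx y hy =>
    dist_zero_two ha0 ha1 (limitSet_subset_triangle hx) (limitSet_subset_triangle hy)⟩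
  pos := dist_pos.2 fun h => by
    have := congrArg (fun p : Plane => p 1) h
    simp [ptA, ptC] at this

lemma isAttractor_quarter (ha0 : 0 < a) (ha1 : a < 1) :
    IsAttractor (pieceMap a) (quarter a) := by
  rw [quarter_eq_limitSet ha0 ha1]
  have hK := isCompact_limitSet ha0 ha1
  have hne : (limitSet a).Nonempty := ⟨ptC, ptC_mem_limitSet ha0 ha1⟩
  have heq := limitSet_eq_iUnion ha0 ha1
  obtain ⟨q, hq1, hq⟩ : ∃ q < 1, ∀ i, pieceRatio a i ≤ q := by
    have h := pieceRatio_lt_one ha0 ha1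
    refine ⟨max (pieceRatio a 0) (max (pieceRatio a 1) (pieceRatio a 2)),
      max_lt (h 0) (max_lt (h 1) (h 2)), fun i => ?_⟩
    fin_cases i <;> simp
  have hlip : ∀ i x y, dist (pieceMap a i x) (pieceMap a i y) ≤ q * dist x y := fun i x y => by
    rw [dist_pieceMap ha0 ha1]
    exact mul_le_mul_of_nonneg_right (hq i) dist_nonneg
  refine ⟨⟨hne, hK, heq⟩, fun L hLn hL hLeq => Subset.antisymm ?_ ?_⟩
  · exact subset_of_invariant hq1 hlip hK hne
      (fun i => (subset_iUnion (fun i => pieceMap a i '' limitSet a) i).trans heq.symm.subset)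
      hL hLeq.subset
  · exact subset_of_invariant hq1 hlip hL hLn
      (fun i => (subset_iUnion (fun i => pieceMap a i '' L) i).trans hLeq.symm.subset)
      hK heq.subset

lemma interior_triangle_nonempty (ha0 : 0 < a) (ha1 : a < 1) : (interior (triangle a)).Nonempty := by
  have hr := ratio_pos ha0 ha1
  have hr' : ratio a = (1 - a ^ 2) / 2 := rfl
  refine ⟨!₂[a, ratio a], mem_interior.2
    ⟨{p | a * p 0 + p 1 < 1 ∧ a < p 0 + a * p 1 ∧ a * (p 0 - a) < p 1},
      fun p hp => ⟨hp.1.le, hp.2.1.le, hp.2.2.le⟩, ?_, ?_⟩⟩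
  · exact (isOpen_lt (by fun_prop) (by fun_prop)).and
      ((isOpen_lt (by fun_prop) (by fun_prop)).and (isOpen_lt (by fun_prop) (by fun_prop)))
  · refine ⟨?_, ?_, ?_⟩ <;> simp
    · nlinarith
    · positivity
    · exact hr

/-- Closed triangles sharing at most one point have disjoint interiors, because a point of the plane
has empty interior. -/
lemma disjoint_image_interior_triangle (ha0 : 0 < a) (ha1 : a < 1) {i j : Fin 3} {z : Plane}
    (h : ∀ x ∈ triangle a, ∀ y ∈ triangle a, pieceMap a i x = pieceMap a j y →
      pieceMap a i x = z) :
    Disjoint (pieceMap a i '' interior (triangle a)) (pieceMap a j '' interior (triangle a)) := by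
  obtain ⟨f, hf⟩ := exists_homeo ha0 ha1 i
  obtain ⟨g, hg⟩ := exists_homeo ha0 ha1 j
  rw [← hf, ← hg] at h ⊢
  rw [f.image_interior, g.image_interior, disjoint_iff_inter_eq_empty, ← interior_inter,
    ← subset_empty_iff, ← interior_singleton z]
  refine interior_mono ?_
  rintro _ ⟨⟨x, hx, rfl⟩, ⟨y, hy, hxy⟩⟩
  exact h x hx y hy hxy.symm

lemma openSetCondition (ha0 : 0 < a) (ha1 : a < 1) :
    OpenSetConditionFor (pieceMap a) (interior (convexHull ℝ {ptA a, ptB a, ptC})) := by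
  rw [convexHull_eq_triangle ha0 ha1]
  refine ⟨interior_triangle_nonempty ha0 ha1,
    (isCompact_triangle ha0 ha1).isBounded.subset interior_subset, isOpen_interior, ?_, ?_⟩
  · refine iUnion_subset fun i => ?_
    have hsub := pieceMap_triangle_subset ha0 ha1 i
    obtain ⟨f, hf⟩ := exists_homeo ha0 ha1 i
    rw [← hf] at hsub ⊢
    rw [f.image_interior]
    exact interior_mono hsub
  · have h01 : Disjoint (pieceMap a 0 '' interior (triangle a))
        (pieceMap a 1 '' interior (triangle a)) :=
      disjoint_image_interior_triangle ha0 ha1 (z := ptG a) fun x hx y hy h => by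
        have := (dist_zero_one ha0 ha1 hx hy).1
        rwa [h, dist_self, mul_zero, dist_le_zero, ← h] at this
    have h12 : Disjoint (pieceMap a 1 '' interior (triangle a))
        (pieceMap a 2 '' interior (triangle a)) :=
      disjoint_image_interior_triangle ha0 ha1 (z := ptH a) fun x hx y hy h => by
        have := (dist_one_two ha0 ha1 hx hy).1
        rwa [h, dist_self, mul_zero, dist_le_zero, ← h] at this
    have h02 : Disjoint (pieceMap a 0 '' interior (triangle a))
        (pieceMap a 2 '' interior (triangle a)) :=
      -- These two pieces do not meet at all, so `z` is arbitrary.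
      disjoint_image_interior_triangle ha0 ha1 (z := 0) fun x hx y hy h => by
        have := dist_zero_two ha0 ha1 hx hy
        rw [h, dist_self] at this
        exact absurd this (not_le.2 (mul_pos ha0 (ratio_pos ha0 ha1)))
    intro i j hij
    fin_cases i <;> fin_cases j
    · exact absurd rfl hij
    · exact h01
    · exact h02
    · exact h01.symm
    · exact absurd rfl hij
    · exact h12
    · exact h02.symm
    · exact h12.symm
    · exact absurd rfl hij

/-- The exponent in Moran's equation exists, is unique and is positive. -/
lemma exists_moran_exponent {p q : ℝ} (hp0 : 0 < p) (hp1 : p < 1) (hq0 : 0 < q) (hq1 : q < 1) :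
    ∃ s : ℝ, 0 < s ∧ p ^ s + 2 * q ^ s = 1 ∧ ∀ t : ℝ, p ^ t + 2 * q ^ t = 1 → t = s := by
  have hanti : StrictAnti fun s : ℝ => p ^ s + 2 * q ^ s := fun s t hst => by
    have h1 := Real.rpow_lt_rpow_of_exponent_gt hp0 hp1 hst
    have h2 := Real.rpow_lt_rpow_of_exponent_gt hq0 hq1 hst
    simp only
    linarith
  have hcont : Continuous fun s : ℝ => p ^ s + 2 * q ^ s :=
    (Real.continuous_const_rpow hp0.ne').add ((Real.continuous_const_rpow hq0.ne').const_mul 2)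
  have hlim : Tendsto (fun s : ℝ => p ^ s + 2 * q ^ s) atTop (𝓝 (0 + 2 * 0)) :=
    (tendsto_rpow_atTop_of_base_lt_one p (by linarith) hp1).add
      ((tendsto_rpow_atTop_of_base_lt_one q (by linarith) hq1).const_mul 2)
  have hev := (hlim.eventually (gt_mem_nhds (by norm_num : (0 + 2 * 0 : ℝ) < 1))).and
    (eventually_gt_atTop 0)
  obtain ⟨t, ht1, ht0⟩ := hev.exists
  -- The sum is `3` at exponent `0` and below `1` at `t`; the value `3` also rules out `s = 0`.
  obtain ⟨s, ⟨hs0, -⟩, hs⟩ := intermediate_value_Icc' ht0.le hcont.continuousOn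
    (show (1 : ℝ) ∈ Icc _ _ from ⟨ht1.le, by norm_num⟩)
  refine ⟨s, hs0.lt_of_ne ?_, hs, fun u hu => hanti.injective (hu.trans hs.symm)⟩
  rintro rfl
  norm_num at hs

end Metric

end Gasket

theorem mainTheorem3 (a : ℝ) (ha0 : 0 < a) (ha1 : a < 1) :
    (∃ S : Fin 3 → Gasket.Plane → Gasket.Plane,
      (Gasket.IsContractingSimilarity (S 0) a ∧
        Gasket.IsContractingSimilarity (S 1) ((1 - a ^ 2) / 2) ∧
        Gasket.IsContractingSimilarity (S 2) ((1 - a ^ 2) / 2)) ∧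
      (S 0 (Gasket.ptA a) = Gasket.ptG a ∧ S 0 (Gasket.ptB a) = Gasket.ptD a ∧
        S 0 Gasket.ptC = Gasket.ptC) ∧
      (S 1 (Gasket.ptA a) = Gasket.ptH a ∧ S 1 (Gasket.ptB a) = Gasket.ptF a ∧
        S 1 Gasket.ptC = Gasket.ptG a) ∧
      (S 2 (Gasket.ptA a) = Gasket.ptH a ∧ S 2 (Gasket.ptB a) = Gasket.ptE a ∧
        S 2 Gasket.ptC = Gasket.ptA a) ∧
      Gasket.IsAttractor S (Gasket.quarter a) ∧
      Gasket.OpenSetConditionFor S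
        (interior (convexHull ℝ {Gasket.ptA a, Gasket.ptB a, Gasket.ptC}))) ∧
    ∃ s : ℝ, 0 ≤ s ∧
      a ^ s + 2 * ((1 - a ^ 2) / 2) ^ s = 1 ∧
      (∀ t : ℝ, a ^ t + 2 * ((1 - a ^ 2) / 2) ^ t = 1 → t = s) ∧
      dimH (Gasket.quarter a) = ENNReal.ofReal s ∧
      dimH (Gasket.fractal a) = ENNReal.ofReal s := by
  refine ⟨⟨Gasket.pieceMap a, ⟨Gasket.isContractingSimilarity_pieceMap ha0 ha1 0,
    Gasket.isContractingSimilarity_pieceMap ha0 ha1 1,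
    Gasket.isContractingSimilarity_pieceMap ha0 ha1 2⟩, Gasket.pieceMap_zero_points ha0,
    Gasket.pieceMap_one_points ha0, Gasket.pieceMap_two_points ha0,
    Gasket.isAttractor_quarter ha0 ha1, Gasket.openSetCondition ha0 ha1⟩, ?_⟩
  obtain ⟨s, hs0, hs, huniq⟩ := Gasket.exists_moran_exponent ha0 ha1
    (Gasket.pieceRatio_pos ha0 ha1 1) (Gasket.pieceRatio_lt_one ha0 ha1 1)
  have hdim : dimH (Gasket.quarter a) = ENNReal.ofReal s := by
    rw [Gasket.quarter_eq_limitSet ha0 ha1]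
    refine (Gasket.isChain_limitSet ha0 ha1).dimH_eq (Gasket.isCompact_limitSet ha0 ha1)
      (Gasket.dist_pieceMap ha0 ha1) (Gasket.isChainGauge_dist ha0 ha1) hs0 ?_
    rw [← hs, two_mul, ← add_assoc]
    rfl
  exact ⟨s, hs0.le, hs, huniq, hdim, (Gasket.dimH_fractal ha0 ha1).trans hdim⟩
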